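/- Let $d,k,t\ge 1$ and $q\ge 2$ be integers such that $k(q-1)>t+d+q-1$, or such that $d=1$ and $k(q-1)>t+2$. A measurable $k$-coloring of $\mathbb{R}^d$ is a map $f:\mathbb{R}^d\to\{1,\dots,k\}$ all of whose color classes $f^{-1}(j)$ are Lebesgue measurable. A necklace is a nontrivial axis-aligned cube $C=\prod_{i=1}^d[a_i,a_i+s]$ with $a\in\mathbb{R}^d$ and $s>0$. A fair $q$-splitting of $C$ (with respect to $f$) using at most $t$ axis-aligned hyperplane cuts is a division of $C$ into cuboids by at most $t$ hyperplanes, each perpendicular to one of the coordinate axes, together with a distribution of these cuboids among $q$ parts such that each part captures exactly $1/q$ of the Lebesgue measure of $C\cap f^{-1}(j)$ for every color $j$. Then there exists a measurable $k$-coloring of $\mathbb{R}^d$ for which no necklace has a fair $q$-splitting using at most $t$ axis-aligned hyperplane cuts. Moreover, the set of (classes of) such colorings is dense in the metric space of all measurable $k$-colorings of $\mathbb{R}^d$, where colorings that differ only on a null set are identified and the distance is $$d(f,g)=\sum_{n=1}^{\infty}\frac{1}{2^n}\cdot\frac{\mathcal{L}(\{x\in[-n,n]^d: f(x)\ne g(x)\})}{(2n)^d},$$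 with $\mathcal{L}$ the Lebesgue measure. -/

import Mathlib

open MeasureTheory
open scoped ENNReal

namespace Necklace

/-- A measurable `k`-coloring of `ℝ^d`: every color class is Lebesgue measurable
(`NullMeasurableSet` for `volume` means measurable up to a Lebesgue null set). -/
structure Coloring (d k : ℕ) where
  color : (Fin d → ℝ) → Fin k
  measurable_color : ∀ j : Fin k, NullMeasurableSet (color ⁻¹' {j}) (volume : Measure (Fin d → ℝ))

/-- The cube `[-n, n]^d`. -/
def centeredCube (d n : ℕ) : Set (Fin d → ℝ) :=
  Set.Icc (fun _ => -(n : ℝ)) (fun _ => (n : ℝ))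

/-- The points of `[-n, n]^d` at which two colorings differ. -/
def diffSet {d k : ℕ} (n : ℕ) (f g : Coloring d k) : Set (Fin d → ℝ) :=
  {x | x ∈ centeredCube d n ∧ f.color x ≠ g.color x}

/-- The normalized distance of two colorings on `[-n, n]^d`. -/
noncomputable def normDist {d k : ℕ} (n : ℕ) (f g : Coloring d k) : ℝ :=
  volume.real (diffSet n f g) / (2 * (n : ℝ)) ^ d

/-- The distance `∑_{n ≥ 1} d_n(f, g) / 2^n` of two colorings. -/
noncomputable def colorDist {d k : ℕ} (f g : Coloring d k) : ℝ :=
  ∑' n : ℕ, normDist (n + 1) f g / 2 ^ (n + 1)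

theorem volume_real_centeredCube (d n : ℕ) :
    volume.real (centeredCube d n) = (2 * (n : ℝ)) ^ d := by
  have h : (fun _ : Fin d => -(n : ℝ)) ≤ fun _ => (n : ℝ) := fun _ => by
    have : (0 : ℝ) ≤ n := Nat.cast_nonneg n
    linarith
  rw [Measure.real, centeredCube, Real.volume_Icc_pi_toReal h]
  simp [two_mul]

theorem volume_diffSet_ne_top {d k : ℕ} (n : ℕ) (f g : Coloring d k) :
    volume (diffSet n f g) ≠ ∞ :=
  ne_top_of_le_ne_top (isCompact_Icc.measure_lt_top (μ := volume)).ne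
    (measure_mono (fun _ hx => hx.1 : diffSet n f g ⊆ centeredCube d n))

theorem normDist_nonneg {d k : ℕ} (n : ℕ) (f g : Coloring d k) : 0 ≤ normDist n f g := by
  unfold normDist
  positivity

theorem normDist_le_one {d k : ℕ} (n : ℕ) (f g : Coloring d k) : normDist n f g ≤ 1 := by
  unfold normDist
  apply div_le_one_of_le₀ _ (by positivity)
  rw [← volume_real_centeredCube]
  exact measureReal_mono (fun _ hx => hx.1) (isCompact_Icc.measure_lt_top (μ := volume)).ne

theorem normDist_triangle {d k : ℕ} (n : ℕ) (f g h : Coloring d k) :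
    normDist n f h ≤ normDist n f g + normDist n g h := by
  unfold normDist
  rw [← add_div]
  gcongr
  refine (measureReal_mono (s₂ := diffSet n f g ∪ diffSet n g h) ?_ ?_).trans
    (measureReal_union_le _ _)
  · rintro x ⟨hx, hne⟩
    by_cases hfg : f.color x = g.color x
    · exact Or.inr ⟨hx, fun e => hne (hfg.trans e)⟩
    · exact Or.inl ⟨hx, hfg⟩
  · exact measure_union_ne_top (volume_diffSet_ne_top n f g) (volume_diffSet_ne_top n g h)

theorem summable_colorDist {d k : ℕ} (f g : Coloring d k) :
    Summable fun n : ℕ => normDist (n + 1) f g / 2 ^ (n + 1) := by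
  refine Summable.of_nonneg_of_le (fun n => div_nonneg (normDist_nonneg _ _ _) (by positivity))
    (fun n => ?_) ((summable_nat_add_iff 1).2 summable_geometric_two)
  rw [one_div, inv_pow, div_eq_mul_inv]
  exact mul_le_of_le_one_left (by positivity) (normDist_le_one _ _ _)

noncomputable instance instPseudoMetricSpaceColoring (d k : ℕ) :
    PseudoMetricSpace (Coloring d k) where
  dist f g := colorDist f g
  dist_self f := by simp [colorDist, normDist, diffSet]
  dist_comm f g := by simp [colorDist, normDist, diffSet, ne_comm]
  dist_triangle f g h := by
    unfold colorDist
    rw [← (summable_colorDist f g).tsum_add (summable_colorDist g h)]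
    refine (summable_colorDist f h).tsum_le_tsum (fun n => ?_)
      ((summable_colorDist f g).add (summable_colorDist g h))
    rw [← add_div]
    gcongr
    exact normDist_triangle _ _ _ _

/-- The metric space of colorings, with colorings at distance zero identified. -/
abbrev ColoringSpace (d k : ℕ) : Type := SeparationQuotient (Coloring d k)

/-- The axis-aligned cube `[a_1, a_1 + s] × ⋯ × [a_d, a_d + s]`. -/
def cube {d : ℕ} (a : Fin d → ℝ) (s : ℝ) : Set (Fin d → ℝ) :=
  Set.Icc a (fun i => a i + s)

/-- A division of the cube `cube a s` by axis-aligned hyperplane cuts, `cuts i` of them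
perpendicular to the `i`-th axis: in direction `i` the coordinates of the cuts, together with the
two end points of the side, are `a i = β_0 ≤ β_1 ≤ ⋯ ≤ β_{cuts i + 1} = a i + s`. -/
structure Division {d : ℕ} (a : Fin d → ℝ) (s : ℝ) where
  cuts : Fin d → ℕ
  coord : (i : Fin d) → Fin (cuts i + 2) → ℝ
  monotone_coord : ∀ i, Monotone (coord i)
  coord_zero : ∀ i, coord i 0 = a i
  coord_last : ∀ i, coord i (Fin.last (cuts i + 1)) = a i + s

namespace Division

variable {d : ℕ} {a : Fin d → ℝ} {s : ℝ}

/-- The total number of hyperplane cuts. -/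
def size (D : Division a s) : ℕ := ∑ i, D.cuts i

/-- The pieces are indexed by choosing one of the `cuts i + 1` subintervals in each direction. -/
abbrev Index (D : Division a s) : Type := (i : Fin d) → Fin (D.cuts i + 1)

/-- The cuboid with index `J`. -/
def piece (D : Division a s) (J : D.Index) : Set (Fin d → ℝ) :=
  Set.Icc (fun i => D.coord i (J i).castSucc) (fun i => D.coord i (J i).succ)

/-- The union of the pieces that a labeling assigns to part `l`. -/
def part (D : Division a s) {q : ℕ} (label : D.Index → Fin q) (l : Fin q) : Set (Fin d → ℝ) :=
  ⋃ J ∈ {J : D.Index | label J = l}, D.piece J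

end Division

/-- The cube `cube a s`, colored by `f`, has a fair `q`-splitting using at most `t` axis-aligned
hyperplane cuts: the pieces of some division can be distributed among `q` parts so that each
part captures exactly `1/q` of the total measure of every color. -/
def HasFairSplitting {d k : ℕ} (f : Coloring d k) (q t : ℕ) (a : Fin d → ℝ) (s : ℝ) : Prop :=
  ∃ D : Division a s, D.size ≤ t ∧ ∃ label : D.Index → Fin q, ∀ (j : Fin k) (l : Fin q),
    volume (D.part label l ∩ f.color ⁻¹' {j}) =
      volume (cube a s ∩ f.color ⁻¹' {j}) / (q : ℝ≥0∞)

/-- No nontrivial axis-aligned cube has a fair `q`-splitting using at most `t` axis-aligned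
hyperplane cuts. -/
def AvoidsFairSplittings {d k : ℕ} (f : Coloring d k) (q t : ℕ) : Prop :=
  ∀ (a : Fin d → ℝ) (s : ℝ), 0 < s → ¬ HasFairSplitting f q t a s

end Necklace

/-!
The colorings for which some cube inside `[-n, n]^d` of side at least `1 / (n + 1)` has a fair
splitting form the set `splittable d k q t n`. A coloring outside all of these has no fair
splitting at all, so by Baire's theorem it is enough that the space of colorings is complete
(`exists_tendsto_of_dist_lt`) and that these sets are closed with dense complement. They are
closed (`isClosed_splittable`) since the cuts range over a compact set and the amount of a color
in a box depends continuously on the box and on the coloring.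

Density of the complement (`dense_compl_splittable`) is a count of degrees of freedom. A given
coloring is approximated by one that is constant on the cells of a fine grid
(`exists_grid_approximation`). Then in each cell one small cube is recolored for every color, such
that the sides of all the recolored cubes are algebraically independent over `ℚ`
(`gridColoring`, `exists_algebraicIndependent_small`).
Suppose that a not too small cube has a fair splitting with respect to this coloring. The grid is
fine, so every part `l` contains a whole cell `Q l` that no cut meets
(`Division.exists_cell_subset`). Let `E` be the algebraic closure in `ℝ` of the field generated by
the coordinates of the cuts and by the sides of the recolored cubes in all the cells but
the `Q l`, where `l` is not a fixed part `l₀`. Boxes with corners in `E` have volumes in `E`, so the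
amount of a color in part `l` is the amount in `Q l` plus an element of `E`. As the amounts in
part `l` and in part `l₀` agree, the sides of the recolored cubes in `Q l` are in `E` as well
(`mem_of_fair`). Thus `(q - 1) * (k - 1)` of the independent numbers are algebraic over the
remaining ones and the coordinates of the cuts, and the rank of these coordinates in the matroid
of algebraic dependence is at least `(q - 1) * (k - 1)` (`encard_le_eRk_of_subset_closure`).

On the other hand, the cube and `t` cuts have `t + d + 1` degrees of freedom, and since one part
has `1 / q` of the volume of the cube, there is a nontrivial algebraic relation between them, so
the rank is at most `t + d` (`Division.eRk_coords_lt_size_add`). In dimension one, the volumes of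
the parts give linear equations, which reduce the rank to at most `t + 3 - q`
(`Division.eRk_coords_add_le`). Under the assumptions on the parameters, both are less than
`(q - 1) * (k - 1)`.
-/

namespace Necklace

open Filter Topology

/-! ### Algebraic dependence of real numbers -/

/-- In a matroid, if an independent set `I` loses a subset `T` and the rest spans `T` again after
adding `Y`, then `Y` has rank at least `|T|`. All the sets may be infinite. -/
theorem encard_le_eRk_of_subset_closure {α : Type*} (M : Matroid α) {I T Y : Set α}
    (hI : M.Indep I) (hTI : T ⊆ I) (hY : Y ⊆ M.E) (h : T ⊆ M.closure ((I \ T) ∪ Y)) :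
    T.encard ≤ M.eRk Y := by
  have hS : M.Indep (I \ T) := hI.subset Set.sdiff_subset
  have hSY : (I \ T) ∪ Y ⊆ M.E := Set.union_subset hS.subset_ground hY
  obtain ⟨K, hK, hSK⟩ := hS.subset_isBasis_of_subset (Set.subset_union_left (t := Y)) hSY
  have hIX : I ⊆ M.closure ((I \ T) ∪ Y) := by
    intro x hx
    by_cases hxT : x ∈ T
    · exact h hxT
    · exact M.subset_closure _ hSY (Or.inl ⟨hx, hxT⟩)
  obtain ⟨J, hJ, hIJ⟩ := hI.subset_isBasis_of_subset hIX (M.closure_subset_ground _)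
  have hK' : M.IsBasis K (M.closure ((I \ T) ∪ Y)) := hK.isBasis_closure_right
  have hcomm := (hJ.isBase_restrict).encard_sdiff_comm (hK'.isBase_restrict)
  have hKY : K \ (I \ T) ⊆ Y := fun x hx => (hK.subset hx.1).resolve_left hx.2
  calc T.encard = (T ∩ K).encard + (T \ K).encard := by
        rw [add_comm]; exact (Set.encard_sdiff_add_encard_inter T K).symm
    _ ≤ (T ∩ K).encard + (J \ K).encard := by
        gcongr
        exact hTI.trans hIJ
    _ = (T ∩ K).encard + (K \ J).encard := by rw [hcomm]
    _ = ((T ∩ K) ∪ (K \ J)).encard := by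
        refine (Set.encard_union_eq ?_).symm
        rw [Set.disjoint_left]
        exact fun x hx hx' => hx'.2 (hIJ (hTI hx.1))
    _ ≤ (K \ (I \ T)).encard := by
        apply Set.encard_le_encard
        rintro x (hx | hx)
        · exact ⟨hx.2, fun h' => h'.2 hx.1⟩
        · exact ⟨hx.1, fun h' => hx.2 (hIJ h'.1)⟩
    _ ≤ M.eRk Y := (hK.indep.subset Set.sdiff_subset).encard_le_eRk_of_subset hKY

/-- The matroid of algebraic dependence over `ℚ` on the real numbers. -/
noncomputable abbrev algMatroid : Matroid ℝ := AlgebraicIndependent.matroid ℚ ℝ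

/-- The real numbers that are algebraic over the field generated by `s`. -/
noncomputable def algSpan (s : Set ℝ) : Subalgebra ℚ ℝ :=
  (Subalgebra.algebraicClosure (Algebra.adjoin ℚ s) ℝ).restrictScalars ℚ

theorem coe_algSpan (s : Set ℝ) : (algSpan s : Set ℝ) = algMatroid.closure s :=
  AlgebraicIndependent.matroid_closure_eq.symm

theorem subset_algSpan (s : Set ℝ) : s ⊆ algSpan s := by
  rw [coe_algSpan]
  exact algMatroid.subset_closure s (Set.subset_univ _)

theorem mem_algSpan_of_pow {s : Set ℝ} {x : ℝ} {n : ℕ} (hn : 0 < n) (h : x ^ n ∈ algSpan s) :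
    x ∈ algSpan s :=
  IsAlgebraic.of_pow (R := Algebra.adjoin ℚ s) hn h

theorem ratCast_mem_subalgebra (E : Subalgebra ℚ ℝ) (r : ℚ) : (r : ℝ) ∈ E := E.algebraMap_mem r

theorem eRk_range_lt_card {ι : Type*} [Fintype ι] {y : ι → ℝ} (h : ¬ AlgebraicIndependent ℚ y) :
    algMatroid.eRk (Set.range y) < Fintype.card ι := by
  by_contra hle
  rw [not_lt] at hle
  have hcard : (Set.range y).encard ≤ Fintype.card ι := by
    rw [← Set.image_univ, ← ENat.card_eq_coe_fintype_card, ← Set.encard_univ]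
    exact Set.encard_image_le _ _
  have hfin : (Set.range y).Finite := Set.finite_range y
  have hind : algMatroid.Indep (Set.range y) :=
    (algMatroid.isRkFinite_of_finite hfin).indep_of_encard_le_eRk (hcard.trans hle)
  have hinj : Function.Injective y := by
    have h1 : Fintype.card ι ≤ (Set.range y).ncard := by
      have := hle.trans (algMatroid.eRk_le_encard _)
      rw [← hfin.cast_ncard_eq] at this
      exact_mod_cast this
    classical
    rw [Set.ncard_eq_toFinset_card', Set.toFinset_range] at h1
    exact Set.injOn_univ.1 (by
      simpa using Finset.card_image_iff.1 (le_antisymm Finset.card_image_le h1))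
  exact h ((algebraicIndependent_subtype_range hinj).1
    (AlgebraicIndependent.matroid_indep_iff.1 hind))

/-- There are countably infinite algebraically independent families of arbitrarily small
positive numbers. -/
theorem exists_algebraicIndependent_small (ι : Type) [Countable ι] {η : ℝ} (hη : 0 < η) :
    ∃ x : ι → ℝ, AlgebraicIndependent ℚ x ∧ ∀ i, 0 < x i ∧ x i < η := by
  obtain ⟨s, hs⟩ := exists_isTranscendenceBasis ℚ ℝ
  have hunc : ¬ s.Countable := by
    intro hc
    have : Countable s := hc
    have h1 : Algebra.IsAlgebraic (Algebra.adjoin ℚ s) ℝ := by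
      have := hs.isAlgebraic
      rwa [Subtype.range_val] at this
    have h2 := Algebra.IsAlgebraic.cardinalMk_le_max (Algebra.adjoin ℚ s) ℝ
    have h3 : Cardinal.mk (Algebra.adjoin ℚ s) ≤ Cardinal.aleph0 := by
      have := Algebra.lift_cardinalMk_adjoin_le ℚ s
      simp only [Cardinal.lift_id] at this
      refine this.trans ?_
      simp
    rw [Cardinal.mk_real, max_eq_right h3] at h2
    exact absurd h2 (not_le.2 Cardinal.aleph0_lt_continuum)
  have hinf : Infinite s := by
    by_contra hf
    rw [not_infinite_iff_finite] at hf
    exact hunc (Set.toFinite s).countable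
  obtain ⟨e⟩ : Nonempty (ι ↪ s) := by
    obtain ⟨f, hf⟩ := exists_injective_nat ι
    exact ⟨(⟨f, hf⟩ : ι ↪ ℕ).trans (Infinite.natEmbedding s)⟩
  have hb : AlgebraicIndependent ℚ (fun i => (e i : ℝ)) := hs.1.comp e e.injective
  have hne : ∀ i, (e i : ℝ) ≠ 0 := fun i => hb.ne_zero i
  have hr : ∀ i, ∃ r : ℚ, 0 < (r : ℝ) * (e i : ℝ) ∧ (r : ℝ) * (e i : ℝ) < η := by
    intro i
    rcases lt_or_gt_of_ne (hne i) with h | h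
    · obtain ⟨r, h1, h2⟩ := exists_rat_btwn (show η / (e i : ℝ) < 0 from div_neg_of_pos_of_neg hη h)
      exact ⟨r, mul_pos_of_neg_of_neg h2 h, by rwa [div_lt_iff_of_neg h] at h1⟩
    · obtain ⟨r, h1, h2⟩ := exists_rat_btwn (show 0 < η / (e i : ℝ) from div_pos hη h)
      exact ⟨r, mul_pos h1 h, by rwa [lt_div_iff₀ h] at h2⟩
  choose r hr using hr
  refine ⟨fun i => (r i : ℝ) * (e i : ℝ), ?_, hr⟩
  have hr0 : ∀ i, r i ≠ 0 := by
    intro i h0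
    have := (hr i).1
    simp [h0] at this
  have htr : ∀ i, Transcendental ℚ (Polynomial.C (r i) * Polynomial.X) := by
    intro i halg
    apply Polynomial.transcendental_X ℚ
    have h1 := (isAlgebraic_algebraMap (A := Polynomial ℚ) (r i)⁻¹).mul halg
    rwa [Polynomial.algebraMap_eq, ← mul_assoc, ← Polynomial.C_mul, inv_mul_cancel₀ (hr0 i),
      Polynomial.C_1, one_mul] at h1
  simpa using hb.polynomial_aeval_of_transcendental htr

/-! ### The metric space of colorings is complete -/

theorem dist_eq_colorDist {d k : ℕ} (f g : Coloring d k) : dist f g = colorDist f g := rfl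

theorem diffSet_mono {d k : ℕ} {m n : ℕ} (h : m ≤ n) (f g : Coloring d k) :
    diffSet m f g ⊆ diffSet n f g := by
  rintro x ⟨⟨h1, h2⟩, hne⟩
  have hmn : (m : ℝ) ≤ n := Nat.cast_le.2 h
  exact ⟨⟨fun i => (neg_le_neg hmn).trans (h1 i), fun i => (h2 i).trans hmn⟩, hne⟩

theorem measureReal_diffSet_mono {d k : ℕ} {m n : ℕ} (h : m ≤ n) (f g : Coloring d k) :
    volume.real (diffSet m f g) ≤ volume.real (diffSet n f g) :=
  measureReal_mono (diffSet_mono h f g) (volume_diffSet_ne_top n f g)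

/-- The term of index `n` of the series alone bounds the distance from below. -/
theorem measureReal_diffSet_le_dist {d k : ℕ} (n : ℕ) (f g : Coloring d k) :
    volume.real (diffSet (n + 1) f g) ≤
      (2 * ((n + 1 : ℕ) : ℝ)) ^ d * 2 ^ (n + 1) * dist f g := by
  have h := (summable_colorDist f g).le_tsum n
    (fun m _ => div_nonneg (normDist_nonneg _ _ _) (by positivity))
  rw [dist_eq_colorDist, colorDist]
  have hpos : (0 : ℝ) < (2 * ((n + 1 : ℕ) : ℝ)) ^ d := by positivity
  rw [normDist, div_div, div_le_iff₀ (by positivity)] at h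
  linarith

/-- The first `n` terms of the series are at most the measure in `[-n, n]^d`, the others at most
`1 / 2 ^ n` in total. -/
theorem dist_le_measureReal_diffSet_add {d k : ℕ} (n : ℕ) (f g : Coloring d k) :
    dist f g ≤ volume.real (diffSet n f g) + (1 / 2) ^ n := by
  rw [dist_eq_colorDist, colorDist, ← (summable_colorDist f g).sum_add_tsum_nat_add n]
  have hgeo : ∀ m : ℕ, (1 : ℝ) / 2 ^ (m + 1) = 1 / 2 / 2 ^ m := fun m => by
    rw [pow_succ]; field_simp
  gcongr
  · have hle : ∀ m ∈ Finset.range n, normDist (m + 1) f g / 2 ^ (m + 1) ≤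
        volume.real (diffSet n f g) * (1 / 2 / 2 ^ m) := by
      intro m hm
      rw [← hgeo, mul_one_div]
      gcongr
      have h1 : (1 : ℝ) ≤ (2 * ((m + 1 : ℕ) : ℝ)) ^ d := by
        apply one_le_pow₀
        push_cast
        linarith [(Nat.cast_nonneg m : (0 : ℝ) ≤ m)]
      exact (div_le_self measureReal_nonneg h1).trans
        (measureReal_diffSet_mono (Finset.mem_range.1 hm) f g)
    refine (Finset.sum_le_sum hle).trans ?_
    rw [← Finset.mul_sum]
    refine mul_le_of_le_one_right measureReal_nonneg ?_
    exact ((summable_geometric_two' 1).sum_le_tsum _ (fun _ _ => by positivity)).trans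
      (tsum_geometric_two' 1).le
  · have hle : ∀ m : ℕ, normDist (m + n + 1) f g / 2 ^ (m + n + 1) ≤
        (1 / 2) ^ n * (1 / 2 / 2 ^ m) := by
      intro m
      refine (div_le_div_of_nonneg_right (normDist_le_one _ _ _) (by positivity)).trans ?_
      rw [← hgeo, show m + n + 1 = n + (m + 1) by omega, pow_add, one_div_pow]
      apply le_of_eq
      field_simp
    have hs : Summable fun m : ℕ => ((1 : ℝ) / 2) ^ n * (1 / 2 / 2 ^ m) :=
      (summable_geometric_two' 1).mul_left _
    refine (Summable.tsum_le_tsum hle ((summable_nat_add_iff n).2 (summable_colorDist f g))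
      hs).trans ?_
    rw [tsum_mul_left, tsum_geometric_two', mul_one]

theorem tendsto_of_measureReal_diffSet {d k : ℕ} {u : ℕ → Coloring d k} {g : Coloring d k}
    (h : ∀ n, Tendsto (fun m => volume.real (diffSet n (u m) g)) atTop (𝓝 0)) :
    Tendsto u atTop (𝓝 g) := by
  rw [Metric.tendsto_atTop]
  intro ε hε
  obtain ⟨n, hn⟩ := exists_pow_lt_of_lt_one (half_pos hε) (show (1 / 2 : ℝ) < 1 by norm_num)
  obtain ⟨N, hN⟩ := eventually_atTop.1 ((h n).eventually (gt_mem_nhds (half_pos hε)))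
  refine ⟨N, fun m hm => (dist_le_measureReal_diffSet_add n (u m) g).trans_lt ?_⟩
  linarith [hN m hm]

theorem exists_mem_centeredCube {d : ℕ} (x : Fin d → ℝ) : ∃ n : ℕ, x ∈ centeredCube d (n + 1) := by
  obtain ⟨n, hn⟩ := exists_nat_ge (∑ i, |x i|)
  refine ⟨n, ?_⟩
  have h : ∀ i, |x i| ≤ ((n + 1 : ℕ) : ℝ) := fun i => by
    have := Finset.single_le_sum (f := fun i => |x i|) (fun i _ => abs_nonneg _) (Finset.mem_univ i)
    push_cast
    linarith
  exact ⟨fun i => (abs_le.1 (h i)).1, fun i => (abs_le.1 (h i)).2⟩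

/-- By the Borel–Cantelli lemma, almost every point eventually keeps its color along the sequence;
the eventual colors are the limit. -/
theorem exists_tendsto_of_dist_lt {d k : ℕ} (u : ℕ → Coloring d k)
    (hu : ∀ m, dist (u m) (u (m + 1)) < (1 / 2) ^ m) : ∃ g, Tendsto u atTop (𝓝 g) := by
  classical
  have hfin : ∀ n, ∑' m, volume (diffSet (n + 1) (u m) (u (m + 1))) ≠ ∞ := by
    intro n
    set C : ℝ := (2 * ((n + 1 : ℕ) : ℝ)) ^ d * 2 ^ (n + 1)
    have hs : Summable fun m : ℕ => C * (1 / 2 : ℝ) ^ m := summable_geometric_two.mul_left C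
    refine ne_top_of_le_ne_top hs.tsum_ofReal_ne_top (ENNReal.tsum_le_tsum fun m => ?_)
    rw [← ENNReal.ofReal_toReal (volume_diffSet_ne_top _ _ _)]
    apply ENNReal.ofReal_le_ofReal
    refine (measureReal_diffSet_le_dist n _ _).trans ?_
    gcongr
    exact (hu m).le
  -- almost every point changes its color only finitely often
  have hae : ∀ᵐ x : Fin d → ℝ, ∃ c, ∀ᶠ m in atTop, (u m).color x = c := by
    have h1 : ∀ᵐ x : Fin d → ℝ, ∀ n, ∀ᶠ m in atTop, x ∉ diffSet (n + 1) (u m) (u (m + 1)) :=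
      ae_all_iff.2 fun n => ae_eventually_notMem (hfin n)
    filter_upwards [h1] with x hx
    obtain ⟨n, hn⟩ := exists_mem_centeredCube x
    obtain ⟨N, hN⟩ := eventually_atTop.1 (hx n)
    refine ⟨(u N).color x, eventually_atTop.2 ⟨N, fun m hm => ?_⟩⟩
    induction m, hm using Nat.le_induction with
    | base => rfl
    | succ m hm ih =>
      rw [← ih]
      by_contra hne
      exact hN m hm ⟨hn, fun e => hne e.symm⟩
  let c : (Fin d → ℝ) → Fin k := fun x =>
    if h : ∃ c, ∀ᶠ m in atTop, (u m).color x = c then h.choose else (u 0).color x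
  have hc : ∀ᵐ x : Fin d → ℝ, ∀ᶠ m in atTop, (u m).color x = c x := by
    filter_upwards [hae] with x hx
    simp only [c, dif_pos hx]
    exact hx.choose_spec
  have hmeas : ∀ j, NullMeasurableSet (c ⁻¹' {j}) (volume : Measure (Fin d → ℝ)) := by
    intro j
    have h1 : NullMeasurableSet (⋃ N : ℕ, ⋂ m : ℕ, ⋂ _ : N ≤ m, (u m).color ⁻¹' {j})
        (volume : Measure (Fin d → ℝ)) :=
      .iUnion fun N => .iInter fun m => .iInter fun _ => (u m).measurable_color j
    refine h1.congr ?_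
    filter_upwards [hc] with x hx
    apply propext
    change x ∈ (⋃ N : ℕ, ⋂ m : ℕ, ⋂ _ : N ≤ m, (u m).color ⁻¹' {j}) ↔ x ∈ c ⁻¹' {j}
    simp only [Set.mem_iUnion, Set.mem_iInter, Set.mem_preimage, Set.mem_singleton_iff]
    constructor
    · rintro ⟨N, hN⟩
      obtain ⟨m, hm, hm'⟩ := (hx.and (eventually_ge_atTop N)).exists
      rw [← hm, hN m hm']
    · intro hj
      obtain ⟨N, hN⟩ := eventually_atTop.1 hx
      exact ⟨N, fun m hm => (hN m hm).trans hj⟩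
  refine ⟨⟨c, hmeas⟩, tendsto_of_measureReal_diffSet fun n => ?_⟩
  have h0 := ENNReal.tendsto_sum_nat_add _ (hfin n)
  have h1 : Tendsto (fun N => volume (diffSet (n + 1) (u N) ⟨c, hmeas⟩)) atTop (𝓝 0) := by
    refine tendsto_of_tendsto_of_tendsto_of_le_of_le tendsto_const_nhds h0
      (fun _ => zero_le) fun N => ?_
    refine (measure_mono_ae ?_).trans (measure_iUnion_le _)
    filter_upwards [hc] with x hx hxN
    change x ∈ ⋃ p, diffSet (n + 1) (u (p + N)) (u (p + N + 1))
    by_contra hnot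
    simp only [Set.mem_iUnion, not_exists] at hnot
    have hconst : ∀ p, (u (p + N)).color x = (u N).color x := by
      intro p
      induction p with
      | zero => simp
      | succ p ih =>
        rw [← ih, show p + 1 + N = p + N + 1 by omega]
        by_contra hne
        exact hnot p ⟨hxN.1, fun e => hne e.symm⟩
    obtain ⟨m, hm, hm'⟩ := (hx.and (eventually_ge_atTop N)).exists
    apply hxN.2
    rw [← hconst (m - N), Nat.sub_add_cancel hm']
    exact hm
  have h2 : Tendsto (fun N => volume.real (diffSet (n + 1) (u N) ⟨c, hmeas⟩)) atTop (𝓝 0) := by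
    have h3 := (ENNReal.tendsto_toReal ENNReal.zero_ne_top).comp h1
    rwa [ENNReal.toReal_zero] at h3
  exact tendsto_of_tendsto_of_tendsto_of_le_of_le tendsto_const_nhds h2
    (fun _ => measureReal_nonneg) fun N => measureReal_diffSet_mono (Nat.le_succ n) _ _

instance instCompleteSpaceColoring (d k : ℕ) : CompleteSpace (Coloring d k) :=
  Metric.complete_of_convergent_controlled_sequences (fun n => (1 / 2) ^ n) (fun n => by positivity)
    fun u hu => exists_tendsto_of_dist_lt u fun m => hu m m (m + 1) le_rfl (Nat.le_succ m)

/-! ### Boxes and pieces of divisions -/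

/-- The half-open box with corners `lo` and `hi`. -/
def box {d : ℕ} (lo hi : Fin d → ℝ) : Set (Fin d → ℝ) :=
  Set.pi Set.univ fun i => Set.Ico (lo i) (hi i)

theorem mem_box {d : ℕ} {lo hi x : Fin d → ℝ} : x ∈ box lo hi ↔ ∀ i, lo i ≤ x i ∧ x i < hi i := by
  simp [box]

theorem box_ae_eq_Icc {d : ℕ} (lo hi : Fin d → ℝ) :
    box lo hi =ᵐ[volume] Set.Icc lo hi :=
  Measure.univ_pi_Ico_ae_eq_Icc

theorem measurableSet_box {d : ℕ} (lo hi : Fin d → ℝ) : MeasurableSet (box lo hi) :=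
  MeasurableSet.univ_pi fun _ => measurableSet_Ico

theorem measureReal_Icc_pi {d : ℕ} (lo hi : Fin d → ℝ) :
    volume.real (Set.Icc lo hi) = ∏ i, max (hi i - lo i) 0 := by
  rw [Measure.real, Real.volume_Icc_pi, ENNReal.toReal_prod]
  simp [ENNReal.toReal_ofReal']

theorem measureReal_box {d : ℕ} (lo hi : Fin d → ℝ) :
    volume.real (box lo hi) = ∏ i, max (hi i - lo i) 0 := by
  rw [← measureReal_Icc_pi, measureReal_congr (box_ae_eq_Icc lo hi)]

theorem box_inter_box {d : ℕ} (lo hi lo' hi' : Fin d → ℝ) :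
    box lo hi ∩ box lo' hi' = box (lo ⊔ lo') (hi ⊓ hi') := by
  ext x
  simp only [Set.mem_inter_iff, mem_box, Pi.sup_apply, Pi.inf_apply, sup_le_iff, lt_inf_iff]
  exact ⟨fun h i => ⟨⟨(h.1 i).1, (h.2 i).1⟩, (h.1 i).2, (h.2 i).2⟩,
    fun h => ⟨fun i => ⟨(h i).1.1, (h i).2.1⟩, fun i => ⟨(h i).1.2, (h i).2.2⟩⟩⟩

namespace Division

variable {d : ℕ} {a : Fin d → ℝ} {s : ℝ}

/-- The half-open version of the cuboid with index `J`. Unlike the closed cuboids, these are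
pairwise disjoint. -/
def openPiece (D : Division a s) (J : D.Index) : Set (Fin d → ℝ) :=
  box (fun i => D.coord i (J i).castSucc) (fun i => D.coord i (J i).succ)

theorem openPiece_ae_eq_piece (D : Division a s) (J : D.Index) :
    D.openPiece J =ᵐ[volume] D.piece J :=
  box_ae_eq_Icc _ _

theorem disjoint_openPiece (D : Division a s) {J J' : D.Index} (h : J ≠ J') :
    Disjoint (D.openPiece J) (D.openPiece J') := by
  obtain ⟨i, hi⟩ := Function.ne_iff.1 h
  rw [Set.disjoint_left]
  intro x hx hx'
  have h1 := mem_box.1 hx i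
  have h2 := mem_box.1 hx' i
  rcases lt_or_gt_of_ne hi with hlt | hlt
  · have := D.monotone_coord i (show (J i).succ ≤ (J' i).castSucc from hlt)
    linarith
  · have := D.monotone_coord i (show (J' i).succ ≤ (J i).castSucc from hlt)
    linarith

theorem measureReal_part_inter (D : Division a s) {q : ℕ} (label : D.Index → Fin q) (l : Fin q)
    {A : Set (Fin d → ℝ)} (hA : NullMeasurableSet A volume) :
    volume.real (D.part label l ∩ A) =
      ∑ J with label J = l, volume.real (D.piece J ∩ A) := by
  have hpart : D.part label l ∩ A =
      ⋃ J ∈ (Finset.univ.filter fun J : D.Index => label J = l), (D.piece J ∩ A) := by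
    rw [part, Set.iUnion₂_inter]
    simp
  rw [hpart]
  refine measureReal_biUnion_finset₀ ?_ ?_ ?_
  · intro J _ J' _ hJ
    have h1 : AEDisjoint volume (D.piece J) (D.piece J') :=
      (D.disjoint_openPiece hJ).aedisjoint.congr (D.openPiece_ae_eq_piece J).symm
        (D.openPiece_ae_eq_piece J').symm
    exact h1.mono Set.inter_subset_left Set.inter_subset_left
  · exact fun J _ => measurableSet_Icc.nullMeasurableSet.inter hA
  · exact fun J _ => ne_top_of_le_ne_top (isCompact_Icc.measure_lt_top (μ := volume)).ne
      (measure_mono Set.inter_subset_left)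

theorem volume_part_ne_top (D : Division a s) {q : ℕ} (label : D.Index → Fin q) (l : Fin q) :
    volume (D.part label l) ≠ ∞ := by
  have h : D.part label l ⊆ ⋃ J : D.Index, D.piece J :=
    Set.iUnion₂_subset fun J _ => Set.subset_iUnion _ J
  refine ne_top_of_le_ne_top ?_ (measure_mono h)
  refine ((measure_iUnion_le _).trans_lt ?_).ne
  rw [tsum_fintype]
  exact ENNReal.sum_lt_top.2 fun J _ => isCompact_Icc.measure_lt_top

/-- The condition of fairness, expressed by the real numbers that measure the pieces. -/
theorem fair_iff_sum (D : Division a s) {q : ℕ} (hq : q ≠ 0) (label : D.Index → Fin q) (l : Fin q)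
    {A : Set (Fin d → ℝ)} (hA : NullMeasurableSet A volume) :
    volume (D.part label l ∩ A) = volume (cube a s ∩ A) / (q : ℝ≥0∞) ↔
      ∑ J with label J = l, volume.real (D.piece J ∩ A) = volume.real (cube a s ∩ A) / q := by
  rw [← D.measureReal_part_inter label l hA]
  have h1 : volume (D.part label l ∩ A) ≠ ∞ :=
    ne_top_of_le_ne_top (D.volume_part_ne_top label l) (measure_mono Set.inter_subset_left)
  have h2 : volume (cube a s ∩ A) / (q : ℝ≥0∞) ≠ ∞ := by
    refine ENNReal.div_ne_top ?_ (by exact_mod_cast hq)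
    exact ne_top_of_le_ne_top (isCompact_Icc.measure_lt_top (μ := volume)).ne
      (measure_mono Set.inter_subset_left)
  rw [← ENNReal.toReal_eq_toReal_iff' h1 h2, ENNReal.toReal_div, ENNReal.toReal_natCast]
  rfl

end Division

/-! ### Colorings with fair splittings of moderate cubes form a closed set -/

/-- The measure of a color inside a closed box depends continuously on the box and on the
coloring. -/
theorem continuous_measureReal_Icc_inter_color {d k : ℕ} (j : Fin k) :
    Continuous fun p : ((Fin d → ℝ) × (Fin d → ℝ)) × Coloring d k =>
      volume.real (Set.Icc p.1.1 p.1.2 ∩ p.2.color ⁻¹' {j}) := by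
  rw [continuous_iff_continuousAt]
  rintro ⟨⟨lo₀, hi₀⟩, f₀⟩
  obtain ⟨n₁, hn₁⟩ := exists_mem_centeredCube lo₀
  obtain ⟨n₂, hn₂⟩ := exists_mem_centeredCube hi₀
  set n := n₁ + n₂ + 1 with hn
  set C : ℝ := (2 * ((n + 1 : ℕ) : ℝ)) ^ d * 2 ^ (n + 1)
  have hfinite : ∀ (lo hi : Fin d → ℝ) (A : Set (Fin d → ℝ)),
      volume (Set.Icc lo hi ∩ A) ≠ ∞ := fun lo hi A =>
    ne_top_of_le_ne_top (isCompact_Icc.measure_lt_top (μ := volume)).ne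
      (measure_mono Set.inter_subset_left)
  -- the dependence on the coloring
  have hcol : ∀ (lo hi : Fin d → ℝ), Set.Icc lo hi ⊆ centeredCube d (n + 1) →
      ∀ f g : Coloring d k, volume.real (Set.Icc lo hi ∩ f.color ⁻¹' {j}) ≤
        volume.real (Set.Icc lo hi ∩ g.color ⁻¹' {j}) + C * dist f g := by
    intro lo hi hsub f g
    refine (measureReal_mono (s₂ := (Set.Icc lo hi ∩ g.color ⁻¹' {j}) ∪ diffSet (n + 1) f g)
      ?_ ?_).trans ((measureReal_union_le _ _).trans ?_)
    · rintro x ⟨hx, hxj⟩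
      by_cases hfg : f.color x = g.color x
      · exact Or.inl ⟨hx, hfg.symm.trans hxj⟩
      · exact Or.inr ⟨hsub hx, hfg⟩
    · exact measure_union_ne_top (hfinite _ _ _) (volume_diffSet_ne_top _ _ _)
    · gcongr
      exact measureReal_diffSet_le_dist n f g
  -- the dependence on the box
  let W : (Fin d → ℝ) × (Fin d → ℝ) → ℝ := fun p =>
    (∏ i, max (max (p.2 i) (hi₀ i) - min (p.1 i) (lo₀ i)) 0) -
      ∏ i, max (min (p.2 i) (hi₀ i) - max (p.1 i) (lo₀ i)) 0
  have hbox : ∀ (lo hi lo' hi' : Fin d → ℝ) (A : Set (Fin d → ℝ)),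
      volume.real (Set.Icc lo hi ∩ A) ≤ volume.real (Set.Icc lo' hi' ∩ A) +
        (volume.real (Set.Icc (lo ⊓ lo') (hi ⊔ hi')) -
          volume.real (Set.Icc (lo ⊔ lo') (hi ⊓ hi'))) := by
    intro lo hi lo' hi' A
    have hsub : Set.Icc (lo ⊔ lo') (hi ⊓ hi') ⊆ Set.Icc (lo ⊓ lo') (hi ⊔ hi') :=
      Set.Icc_subset_Icc (inf_le_left.trans le_sup_left) (inf_le_left.trans le_sup_left)
    rw [← measureReal_sdiff hsub measurableSet_Icc
      (isCompact_Icc.measure_lt_top (μ := volume)).ne]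
    refine (measureReal_mono ?_ ?_).trans (measureReal_union_le _ _)
    · rintro x ⟨hx, hxA⟩
      by_cases hx' : x ∈ Set.Icc lo' hi'
      · exact Or.inl ⟨hx', hxA⟩
      · refine Or.inr ⟨⟨inf_le_left.trans hx.1, hx.2.trans le_sup_left⟩, fun h => hx' ?_⟩
        exact ⟨le_sup_right.trans h.1, h.2.trans inf_le_right⟩
    · exact measure_union_ne_top (hfinite _ _ _)
        (ne_top_of_le_ne_top (isCompact_Icc.measure_lt_top (μ := volume)).ne
          (measure_mono Set.sdiff_subset))
  have hW : ∀ lo hi, volume.real (Set.Icc (lo ⊓ lo₀) (hi ⊔ hi₀)) -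
      volume.real (Set.Icc (lo ⊔ lo₀) (hi ⊓ hi₀)) = W (lo, hi) := by
    intro lo hi
    simp [W, measureReal_Icc_pi]
  have hWcont : Continuous W := by
    unfold W
    fun_prop
  have hW0 : W (lo₀, hi₀) = 0 := by simp [W]
  have hev : ∀ᶠ p : ((Fin d → ℝ) × (Fin d → ℝ)) × Coloring d k in 𝓝 ((lo₀, hi₀), f₀),
      Set.Icc p.1.1 p.1.2 ⊆ centeredCube d (n + 1) := by
    have h1 : ∀ᶠ p : ((Fin d → ℝ) × (Fin d → ℝ)) × Coloring d k in 𝓝 ((lo₀, hi₀), f₀),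
        ∀ i, -((n + 1 : ℕ) : ℝ) < p.1.1 i := by
      refine eventually_all.2 fun i => ?_
      have hc : Continuous fun p : ((Fin d → ℝ) × (Fin d → ℝ)) × Coloring d k => p.1.1 i := by
        fun_prop
      refine hc.continuousAt.eventually (lt_mem_nhds ?_)
      have := hn₁.1 i
      simp only [hn]
      push_cast at this ⊢
      linarith [(Nat.cast_nonneg n₂ : (0 : ℝ) ≤ n₂)]
    have h2 : ∀ᶠ p : ((Fin d → ℝ) × (Fin d → ℝ)) × Coloring d k in 𝓝 ((lo₀, hi₀), f₀),
        ∀ i, p.1.2 i < ((n + 1 : ℕ) : ℝ) := by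
      refine eventually_all.2 fun i => ?_
      have hc : Continuous fun p : ((Fin d → ℝ) × (Fin d → ℝ)) × Coloring d k => p.1.2 i := by
        fun_prop
      refine hc.continuousAt.eventually (gt_mem_nhds ?_)
      have := hn₂.2 i
      simp only [hn]
      push_cast at this ⊢
      linarith [(Nat.cast_nonneg n₁ : (0 : ℝ) ≤ n₁)]
    filter_upwards [h1, h2] with p hp1 hp2
    exact Set.Icc_subset_Icc (fun i => (hp1 i).le) (fun i => (hp2 i).le)
  rw [ContinuousAt, tendsto_iff_dist_tendsto_zero]
  have hlim : Tendsto (fun p : ((Fin d → ℝ) × (Fin d → ℝ)) × Coloring d k =>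
      C * dist p.2 f₀ + W p.1) (𝓝 ((lo₀, hi₀), f₀)) (𝓝 0) := by
    have hc : Continuous fun p : ((Fin d → ℝ) × (Fin d → ℝ)) × Coloring d k =>
        C * dist p.2 f₀ + W p.1 := by fun_prop
    have := hc.tendsto ((lo₀, hi₀), f₀)
    simpa [hW0] using this
  refine squeeze_zero' (Eventually.of_forall fun _ => dist_nonneg) ?_ hlim
  filter_upwards [hev] with p hp
  rw [Real.dist_eq, abs_le]
  have e1 := hcol _ _ hp p.2 f₀
  have e2 := hcol _ _ hp f₀ p.2
  have e3 := hbox p.1.1 p.1.2 lo₀ hi₀ (f₀.color ⁻¹' {j})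
  have e4 := hbox lo₀ hi₀ p.1.1 p.1.2 (f₀.color ⁻¹' {j})
  rw [hW] at e3
  rw [inf_comm, sup_comm, sup_comm lo₀, inf_comm hi₀, hW] at e4
  rw [dist_comm] at e2
  constructor <;> linarith

/-- The colorings for which some cube inside `[-n, n]^d` of side at least `1 / (n + 1)` has a
fair splitting. -/
def splittable (d k q t n : ℕ) : Set (Coloring d k) :=
  {f | ∃ (a : Fin d → ℝ) (s : ℝ), cube a s ⊆ centeredCube d n ∧ 1 / ((n : ℝ) + 1) ≤ s ∧
    HasFairSplitting f q t a s}

/-- The requirements on the coordinates `β` of the cuts of a cube of side `s`, for given numbers of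
cuts `c` and a given labeling of the pieces, that make up a fair splitting. -/
def FairCoords {d k : ℕ} (q n : ℕ) (c : Fin d → ℕ) (label : ((i : Fin d) → Fin (c i + 1)) → Fin q)
    (β : (i : Fin d) → Fin (c i + 2) → ℝ) (s : ℝ) (f : Coloring d k) : Prop :=
  (∀ i, Monotone (β i)) ∧ (∀ i, β i (Fin.last (c i + 1)) = β i 0 + s) ∧
    (∀ i, -(n : ℝ) ≤ β i 0) ∧ (∀ i, β i (Fin.last (c i + 1)) ≤ n) ∧
    ∀ (j : Fin k) (l : Fin q),
      ∑ J with label J = l, volume.real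
        (Set.Icc (fun i => β i (J i).castSucc) (fun i => β i (J i).succ) ∩ f.color ⁻¹' {j}) =
      volume.real
        (Set.Icc (fun i => β i 0) (fun i => β i (Fin.last (c i + 1))) ∩ f.color ⁻¹' {j}) / q

theorem isClosed_fairCoords {d k : ℕ} (q n : ℕ) (c : Fin d → ℕ)
    (label : ((i : Fin d) → Fin (c i + 1)) → Fin q) :
    IsClosed {p : (((i : Fin d) → Fin (c i + 2) → ℝ) × ℝ) × Coloring d k |
      FairCoords q n c label p.1.1 p.1.2 p.2} := by
  have hcont : ∀ (j : Fin k) (u v : (i : Fin d) → Fin (c i + 2)),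
      Continuous fun p : (((i : Fin d) → Fin (c i + 2) → ℝ) × ℝ) × Coloring d k =>
        volume.real (Set.Icc (fun i => p.1.1 i (u i)) (fun i => p.1.1 i (v i)) ∩
          p.2.color ⁻¹' {j}) := by
    intro j u v
    exact (continuous_measureReal_Icc_inter_color j).comp
      (f := fun p : (((i : Fin d) → Fin (c i + 2) → ℝ) × ℝ) × Coloring d k =>
        (((fun i => p.1.1 i (u i)), (fun i => p.1.1 i (v i))), p.2)) (by fun_prop)
  simp only [FairCoords, Monotone, Set.ofPred_and, Set.ofPred_forall]
  refine .inter ?_ (.inter ?_ (.inter ?_ (.inter ?_ ?_)))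
  · exact isClosed_iInter fun i => isClosed_iInter fun x => isClosed_iInter fun y =>
      isClosed_iInter fun _ => isClosed_le (by fun_prop) (by fun_prop)
  · exact isClosed_iInter fun i => isClosed_eq (by fun_prop) (by fun_prop)
  · exact isClosed_iInter fun i => isClosed_le (by fun_prop) (by fun_prop)
  · exact isClosed_iInter fun i => isClosed_le (by fun_prop) (by fun_prop)
  · exact isClosed_iInter fun j => isClosed_iInter fun l => isClosed_eq
      (continuous_finsetSum _ fun J _ =>
        hcont j (fun i => (J i).castSucc) (fun i => (J i).succ))
      ((hcont j (fun i => 0) (fun i => Fin.last (c i + 1))).div_const _)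

theorem mem_splittable_iff {d k q t n : ℕ} (hd : 1 ≤ d) (hq : q ≠ 0) {f : Coloring d k} :
    f ∈ splittable d k q t n ↔ ∃ c : Fin d → Fin (t + 1), ∑ i, (c i : ℕ) ≤ t ∧
      ∃ label : ((i : Fin d) → Fin ((c i : ℕ) + 1)) → Fin q,
        ∃ p ∈ (Set.Icc (fun _ _ => -(n : ℝ)) (fun _ _ => (n : ℝ)) :
            Set ((i : Fin d) → Fin ((c i : ℕ) + 2) → ℝ)) ×ˢ
              Set.Icc (1 / ((n : ℝ) + 1)) (2 * (n : ℝ)),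
          FairCoords q n (fun i => (c i : ℕ)) label p.1 p.2 f := by
  constructor
  · rintro ⟨a, s, hsub, hs, D, hD, label, hfair⟩
    have hs0 : 0 < s := lt_of_lt_of_le (by positivity) hs
    have ha : a ∈ cube a s := ⟨le_rfl, fun i => by simp [hs0.le]⟩
    have ha' : (fun i => a i + s) ∈ cube a s := ⟨fun i => by simp [hs0.le], le_rfl⟩
    have hlo := (hsub ha).1
    have hhi := (hsub ha').2
    have hc : ∀ i, D.cuts i < t + 1 := fun i => by
      have := Finset.single_le_sum (f := D.cuts) (fun _ _ => Nat.zero_le _) (Finset.mem_univ i)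
      exact Nat.lt_succ_of_le (this.trans hD)
    refine ⟨fun i => ⟨D.cuts i, hc i⟩, hD, label, (D.coord, s), ⟨⟨?_, ?_⟩, hs, ?_⟩,
      D.monotone_coord, ?_, ?_, ?_, ?_⟩
    · intro i x
      refine (hlo i).trans ?_
      rw [← D.coord_zero i]
      exact D.monotone_coord i (Fin.zero_le x)
    · intro i x
      refine le_trans ?_ (hhi i)
      change D.coord i x ≤ a i + s
      rw [← D.coord_last i]
      exact D.monotone_coord i (Fin.le_last x)
    · have h1 := hlo ⟨0, hd⟩
      have h2 := hhi ⟨0, hd⟩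
      simp only at h1 h2 ⊢
      linarith
    · intro i
      exact (D.coord_last i).trans (by rw [← D.coord_zero i])
    · intro i
      exact (hlo i).trans (D.coord_zero i).ge
    · intro i
      exact (D.coord_last i).le.trans (hhi i)
    · intro j l
      have := (D.fair_iff_sum hq label l (f.measurable_color j)).1 (hfair j l)
      refine this.trans ?_
      have e1 : (fun i => D.coord i 0) = a := funext D.coord_zero
      have e2 : (fun i => D.coord i (Fin.last (D.cuts i + 1))) = fun i => a i + s :=
        funext D.coord_last
      change _ = volume.real (Set.Icc (fun i => D.coord i 0)
        (fun i => D.coord i (Fin.last (D.cuts i + 1))) ∩ _) / _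
      rw [e1, e2]
      rfl
  · rintro ⟨c, hc, label, ⟨β, s⟩, ⟨-, hs⟩, hmono, hlast, hlo, hhi, hfair⟩
    let D : Division (fun i => β i 0) s := ⟨fun i => c i, β, hmono, fun _ => rfl, hlast⟩
    refine ⟨fun i => β i 0, s, ?_, hs.1, D, hc, label, fun j l => ?_⟩
    · refine Set.Icc_subset_Icc hlo fun i => ?_
      exact (hlast i).ge.trans (hhi i)
    · rw [D.fair_iff_sum hq label l (f.measurable_color j)]
      refine (hfair j l).trans ?_
      have e2 : (fun i => β i (Fin.last ((c i : ℕ) + 1))) = fun i => β i 0 + s := funext hlast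
      rw [e2]
      rfl

/-- Up to finitely many choices of the numbers of cuts and of the labeling, the set is the
projection of a closed set along a compact space of coordinates of cuts. -/
theorem isClosed_splittable {d k q t : ℕ} (n : ℕ) (hd : 1 ≤ d) (hq : q ≠ 0) :
    IsClosed (splittable d k q t n) := by
  have h : splittable d k q t n = ⋃ c : Fin d → Fin (t + 1), ⋃ _ : ∑ i, (c i : ℕ) ≤ t,
      ⋃ label : ((i : Fin d) → Fin ((c i : ℕ) + 1)) → Fin q,
        {f | ∃ p ∈ (Set.Icc (fun _ _ => -(n : ℝ)) (fun _ _ => (n : ℝ)) :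
            Set ((i : Fin d) → Fin ((c i : ℕ) + 2) → ℝ)) ×ˢ
              Set.Icc (1 / ((n : ℝ) + 1)) (2 * (n : ℝ)),
          FairCoords q n (fun i => (c i : ℕ)) label p.1 p.2 f} := by
    ext f
    rw [mem_splittable_iff hd hq]
    simp
  rw [h]
  refine isClosed_iUnion_of_finite fun c => isClosed_iUnion_of_finite fun _ =>
    isClosed_iUnion_of_finite fun label => ?_
  set K : Set (((i : Fin d) → Fin ((c i : ℕ) + 2) → ℝ) × ℝ) :=
    (Set.Icc (fun _ _ => -(n : ℝ)) (fun _ _ => (n : ℝ))) ×ˢ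
      Set.Icc (1 / ((n : ℝ) + 1)) (2 * (n : ℝ)) with hK
  have : CompactSpace K := isCompact_iff_compactSpace.1 (isCompact_Icc.prod isCompact_Icc)
  have hcl : IsClosed {p : K × Coloring d k |
      FairCoords q n (fun i => (c i : ℕ)) label p.1.1.1 p.1.1.2 p.2} :=
    (isClosed_fairCoords q n (fun i => (c i : ℕ)) label).preimage
      (f := fun p : K × Coloring d k =>
        ((p.1 : ((i : Fin d) → Fin ((c i : ℕ) + 2) → ℝ) × ℝ), p.2)) (by fun_prop)
  convert! isClosedMap_snd_of_compactSpace _ hcl using 1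
  ext f
  simp

/-! ### The algebraic rank of the cuts of a division into parts of equal volume -/

theorem eRk_le_of_subset_algSpan {X Y : Set ℝ} (h : X ⊆ algSpan Y) :
    algMatroid.eRk X ≤ algMatroid.eRk Y := by
  rw [coe_algSpan] at h
  exact (algMatroid.eRk_mono h).trans (algMatroid.eRk_closure_eq Y).le

namespace Division

variable {d : ℕ} {a : Fin d → ℝ} {s : ℝ}

/-- All the coordinates of the cuts and of the faces of the cube. -/
def coords (D : Division a s) : Set ℝ :=
  Set.range fun p : (i : Fin d) × Fin (D.cuts i + 2) => D.coord p.1 p.2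

theorem coord_mem_coords (D : Division a s) (i : Fin d) (c : Fin (D.cuts i + 2)) :
    D.coord i c ∈ D.coords :=
  ⟨⟨i, c⟩, rfl⟩

/-- Every part has `1 / q` of the volume of the cube. The volume of a part is written as the sum of
the products of the side lengths of its pieces. -/
def EqualVolumes (D : Division a s) {q : ℕ} (label : D.Index → Fin q) : Prop :=
  ∀ l, ∑ J with label J = l, ∏ i, (D.coord i (J i).succ - D.coord i (J i).castSucc) = s ^ d / q

/-- The cube and its cuts have `size + d + 1` degrees of freedom. The volume of one part imposes a
nontrivial polynomial relation with rational coefficients, so the rank is smaller. -/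
theorem eRk_coords_lt_size_add (D : Division a s) {q : ℕ} (hq : 2 ≤ q) (label : D.Index → Fin q)
    (hvol : D.EqualVolumes label) : algMatroid.eRk D.coords < (D.size + d + 1 : ℕ) := by
  let y : Option ((i : Fin d) × Fin (D.cuts i + 1)) → ℝ :=
    fun o => o.elim s fun p => D.coord p.1 p.2.castSucc
  let z : Option ((i : Fin d) × Fin (D.cuts i + 1)) → ℝ := fun o => o.elim 1 fun _ => 0
  -- the coordinates as polynomials in `s` and the coordinates below the last face in each direction
  let V : (i : Fin d) → Fin (D.cuts i + 2) →
      MvPolynomial (Option ((i : Fin d) × Fin (D.cuts i + 1))) ℚ := fun i =>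
    Fin.lastCases (MvPolynomial.X (some ⟨i, 0⟩) + MvPolynomial.X none)
      fun c => MvPolynomial.X (some ⟨i, c⟩)
  have hVy : ∀ i c, MvPolynomial.aeval y (V i c) = D.coord i c := by
    intro i c
    induction c using Fin.lastCases with
    | last =>
      simp only [V, Fin.lastCases_last, map_add, MvPolynomial.aeval_X]
      rw [D.coord_last i, ← D.coord_zero i]
      rfl
    | cast c =>
      simp only [V, Fin.lastCases_castSucc, MvPolynomial.aeval_X]
      rfl
  -- `z` is the unit cube at the origin with all the cuts in its lower faces
  have hVz : ∀ i c, MvPolynomial.aeval z (V i c) =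
      ((if c = Fin.last _ then 1 else 0 : ℤ) : ℝ) := by
    intro i c
    induction c using Fin.lastCases with
    | last => simp [V, z]
    | cast c => simp [V, z, (Fin.castSucc_lt_last c).ne]
  let l₀ : Fin q := ⟨0, by omega⟩
  let P : MvPolynomial (Option ((i : Fin d) × Fin (D.cuts i + 1))) ℚ :=
    MvPolynomial.C (q : ℚ) *
      (∑ J with label J = l₀, ∏ i, (V i (J i).succ - V i (J i).castSucc)) -
        MvPolynomial.X none ^ d
  have hq0 : (q : ℝ) ≠ 0 := by positivity
  have hdep : ¬ AlgebraicIndependent ℚ y := by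
    intro hind
    have hPy : MvPolynomial.aeval y P = 0 := by
      simp only [P, map_sub, map_mul, map_sum, map_prod, map_pow, MvPolynomial.aeval_X, hVy]
      rw [hvol l₀]
      simp only [y, Option.elim_none, map_natCast]
      field_simp
      simp
    have hP : P = 0 := hind.eq_zero_of_aeval_eq_zero P hPy
    -- at the point `z`, one piece is the whole cube and the other pieces are degenerate
    have hPz : MvPolynomial.aeval z P = 0 := by rw [hP, map_zero]
    simp only [P, map_sub, map_mul, map_sum, map_prod, map_pow, MvPolynomial.aeval_X, hVz] at hPz
    simp only [z, Option.elim_none, map_natCast, one_pow] at hPz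
    have hint : (q : ℤ) * (∑ J with label J = l₀, ∏ i,
        ((if (J i).succ = Fin.last _ then 1 else 0 : ℤ) -
          (if (J i).castSucc = Fin.last _ then 1 else 0 : ℤ))) = 1 := by
      have := sub_eq_zero.1 hPz
      exact_mod_cast this
    have hdvd : (q : ℤ) ∣ 1 := ⟨_, hint.symm⟩
    have := Int.le_of_dvd one_pos hdvd
    omega
  have hsub : D.coords ⊆ algSpan (Set.range y) := by
    rintro _ ⟨⟨i, c⟩, rfl⟩
    have hy : ∀ o, y o ∈ algSpan (Set.range y) := fun o => subset_algSpan _ ⟨o, rfl⟩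
    induction c using Fin.lastCases with
    | last =>
      change D.coord i (Fin.last _) ∈ algSpan _
      rw [D.coord_last i, ← D.coord_zero i]
      exact add_mem (hy (some ⟨i, 0⟩)) (hy none)
    | cast c => exact hy (some ⟨i, c⟩)
  refine (eRk_le_of_subset_algSpan hsub).trans_lt ((eRk_range_lt_card hdep).trans_le ?_)
  rw [Fintype.card_option, Fintype.card_sigma]
  simp [size, Finset.sum_add_distrib]

/-- On the line, the lengths of the pieces satisfy `q` linear equations, one for each part. As
every piece occurs in just one of these, they determine the lengths of `q` pieces, one from each
part, by the lengths of the other pieces. -/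
theorem eRk_coords_add_le {a : Fin 1 → ℝ} (D : Division a s) {q : ℕ} (hs : 0 < s)
    (label : D.Index → Fin q) (hvol : D.EqualVolumes label) :
    algMatroid.eRk D.coords + q ≤ (D.size + 3 : ℕ) := by
  classical
  let w : D.Index → ℝ := fun J => D.coord 0 (J 0).succ - D.coord 0 (J 0).castSucc
  have hw : ∀ l, ∑ J with label J = l, w J = s / q := by
    intro l
    simpa only [Finset.univ_unique, Finset.prod_singleton, Fin.default_eq_zero, pow_one]
      using hvol l
  have hex : ∀ l, ∃ J, label J = l := by
    intro l
    by_contra! hne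
    have hq : (0 : ℝ) < q := by exact_mod_cast l.pos
    have h0 : s / q = 0 := by
      rw [← hw l, Finset.filter_false_of_mem (fun J _ => hne J), Finset.sum_empty]
    have := div_pos hs hq
    linarith
  choose J₀ hJ₀ using hex
  have hinj : Function.Injective J₀ := fun l l' h => by rw [← hJ₀ l, ← hJ₀ l', h]
  let R : Finset D.Index := Finset.univ.image J₀
  have hR : R.card = q := by
    rw [Finset.card_image_of_injective _ hinj, Finset.card_univ, Fintype.card_fin]
  let Y : Finset ℝ := {a 0, s} ∪ Rᶜ.image w
  have hcard : Fintype.card D.Index = D.size + 1 := by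
    rw [Fintype.card_pi]
    simp [size]
  have hY : Y.card + q ≤ D.size + 3 := by
    have h1 : Y.card ≤ 2 + (Rᶜ).card :=
      (Finset.card_union_le _ _).trans (add_le_add Finset.card_le_two Finset.card_image_le)
    have h2 := R.card_add_card_compl
    omega
  have hmem : ∀ x ∈ Y, x ∈ algSpan (Y : Set ℝ) := fun x hx => subset_algSpan _ hx
  have ha : a 0 ∈ algSpan (Y : Set ℝ) := hmem _ (by simp [Y])
  have hsY : s ∈ algSpan (Y : Set ℝ) := hmem _ (by simp [Y])
  have hwR : ∀ J, J ∉ R → w J ∈ algSpan (Y : Set ℝ) := fun J hJ =>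
    hmem _ (Finset.mem_union_right _ (Finset.mem_image_of_mem w (Finset.mem_compl.2 hJ)))
  have hwY : ∀ J, w J ∈ algSpan (Y : Set ℝ) := by
    intro J
    by_cases hJ : J ∈ R
    · obtain ⟨l, -, rfl⟩ := Finset.mem_image.1 hJ
      have hl := hw l
      rw [← Finset.add_sum_erase _ _ (Finset.mem_filter.2 ⟨Finset.mem_univ (J₀ l), hJ₀ l⟩)] at hl
      rw [eq_sub_of_add_eq hl]
      refine sub_mem ?_ (sum_mem fun J hJ' => hwR J fun hJR => ?_)
      · rw [div_eq_mul_inv]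
        refine mul_mem hsY ?_
        have := ratCast_mem_subalgebra (algSpan (Y : Set ℝ)) (q : ℚ)⁻¹
        simpa using this
      · obtain ⟨l', -, rfl⟩ := Finset.mem_image.1 hJR
        have h1 := Finset.mem_erase.1 hJ'
        have h2 := (Finset.mem_filter.1 h1.2).2
        rw [hJ₀] at h2
        exact h1.1 (by rw [h2])
    · exact hwR J hJ
  have hsub : D.coords ⊆ algSpan (Y : Set ℝ) := by
    rintro _ ⟨⟨i, c⟩, rfl⟩
    obtain rfl : i = 0 := Subsingleton.elim _ _
    change D.coord 0 c ∈ algSpan _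
    induction c using Fin.induction with
    | zero => rwa [D.coord_zero]
    | succ c ih =>
      have := add_mem ih (hwY (Fin.cases c fun i => i.elim0))
      simpa [w] using this
  calc algMatroid.eRk D.coords + q ≤ (Y.card : ℕ∞) + q := by
        gcongr
        refine (eRk_le_of_subset_algSpan hsub).trans ((algMatroid.eRk_le_encard _).trans ?_)
        rw [Set.encard_coe_eq_coe_finsetCard]
    _ ≤ (D.size + 3 : ℕ) := by exact_mod_cast hY

theorem eRk_coords_lt {k t q : ℕ} (hk : 1 ≤ k) (hq : 2 ≤ q)
    (h : t + d + (q - 1) < k * (q - 1) ∨ (d = 1 ∧ t + 2 < k * (q - 1)))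
    (D : Division a s) (hs : 0 < s) (hD : D.size ≤ t) (label : D.Index → Fin q)
    (hvol : D.EqualVolumes label) : algMatroid.eRk D.coords < (q - 1) * (k - 1) := by
  have hmul : k * (q - 1) = (q - 1) * (k - 1) + (q - 1) := by
    obtain ⟨k, rfl⟩ := Nat.exists_eq_add_of_le' hk
    rw [Nat.add_sub_cancel]
    ring
  have hcast : (q - 1 : ℕ∞) * (k - 1) = (((q - 1) * (k - 1) : ℕ) : ℕ∞) := by
    push_cast
    rfl
  rw [hcast]
  rcases h with h | ⟨rfl, h⟩
  · refine (D.eRk_coords_lt_size_add hq label hvol).trans_le ?_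
    norm_cast
    omega
  · have h1 := D.eRk_coords_add_le hs label hvol
    generalize algMatroid.eRk D.coords = r at h1 ⊢
    induction r using ENat.recTopCoe with
    | top => simp at h1
    | coe r =>
      norm_cast at h1 ⊢
      omega

end Division

/-! ### Grid colorings with small recolored cubes -/

theorem sum_measureReal_inter_color {d k : ℕ} (f : Coloring d k) {A : Set (Fin d → ℝ)}
    (hA : NullMeasurableSet A volume) (hfin : volume A ≠ ∞) :
    ∑ j, volume.real (A ∩ f.color ⁻¹' {j}) = volume.real A := by
  rw [← measureReal_biUnion_finset₀]
  · congr 1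
    ext x
    simp
  · intro j _ j' _ hj
    refine Disjoint.aedisjoint (Set.disjoint_left.2 fun x hx hx' => hj ?_)
    exact hx.2.symm.trans hx'.2
  · exact fun j _ => hA.inter (f.measurable_color j)

theorem volume_box_ne_top {d : ℕ} (lo hi : Fin d → ℝ) : volume (box lo hi) ≠ ∞ := by
  rw [measure_congr (box_ae_eq_Icc lo hi)]
  exact isCompact_Icc.measure_lt_top.ne

/-- The volume of a box is a polynomial in the coordinates of the corners, or zero. -/
theorem measureReal_box_mem {d : ℕ} (E : Subalgebra ℚ ℝ) {lo hi : Fin d → ℝ} (hlo : ∀ i, lo i ∈ E)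
    (hhi : ∀ i, hi i ∈ E) : volume.real (box lo hi) ∈ E := by
  rw [measureReal_box]
  refine prod_mem fun i _ => ?_
  rcases max_choice (hi i - lo i) 0 with h | h <;> rw [h]
  · exact sub_mem (hhi i) (hlo i)
  · exact zero_mem E

theorem measureReal_box_inter_box_mem {d : ℕ} (E : Subalgebra ℚ ℝ) {lo hi lo' hi' : Fin d → ℝ}
    (hlo : ∀ i, lo i ∈ E) (hhi : ∀ i, hi i ∈ E) (hlo' : ∀ i, lo' i ∈ E) (hhi' : ∀ i, hi' i ∈ E) :
    volume.real (box lo hi ∩ box lo' hi') ∈ E := by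
  rw [box_inter_box]
  refine measureReal_box_mem E (fun i => ?_) (fun i => ?_)
  · rcases max_choice (lo i) (lo' i) with h | h <;> rw [Pi.sup_apply, h]
    exacts [hlo i, hlo' i]
  · rcases min_choice (hi i) (hi' i) with h | h <;> rw [Pi.inf_apply, h]
    exacts [hhi i, hhi' i]

/-- The cell of the grid of mesh `δ` that contains a given point. -/
noncomputable def cellIndex {d : ℕ} (δ : ℚ) (p : Fin d → ℝ) : Fin d → ℤ := fun i => ⌊p i / δ⌋

/-- The half-open cells of the grid of mesh `δ`. -/
def cell {d : ℕ} (δ : ℚ) (Q : Fin d → ℤ) : Set (Fin d → ℝ) :=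
  box (fun i => (δ : ℝ) * Q i) (fun i => (δ : ℝ) * (Q i + 1))

theorem mem_cell_iff {d : ℕ} {δ : ℚ} (hδ : 0 < δ) {Q : Fin d → ℤ} {p : Fin d → ℝ} :
    p ∈ cell δ Q ↔ cellIndex δ p = Q := by
  have hδ' : (0 : ℝ) < δ := by exact_mod_cast hδ
  rw [cell, mem_box, funext_iff]
  refine forall_congr' fun i => ?_
  rw [cellIndex, Int.floor_eq_iff, le_div_iff₀ hδ', div_lt_iff₀ hδ', mul_comm, mul_comm (δ : ℝ)]

theorem corner_mem_cell {d : ℕ} {δ : ℚ} (hδ : 0 < δ) (Q : Fin d → ℤ) :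
    (fun i => (δ : ℝ) * Q i) ∈ cell δ Q := by
  have hδ' : (0 : ℝ) < δ := by exact_mod_cast hδ
  exact mem_box.2 fun i => ⟨le_rfl, by linarith⟩

/-- The cube of side `x (Q, j)` in the cell `Q` that is to be recolored with color `j`. The cubes
for the different colors lie one after the other along the diagonal of the cell. -/
def recolored {d k : ℕ} (δ : ℚ) (x : (Fin d → ℤ) × Fin k → ℝ) (Q : Fin d → ℤ) (j : Fin k) :
    Set (Fin d → ℝ) :=
  box (fun i => (δ : ℝ) * (Q i + (j : ℕ) / k)) (fun i => (δ : ℝ) * (Q i + (j : ℕ) / k) + x (Q, j))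

section gridColor

variable {d k : ℕ} {δ : ℚ} {x : (Fin d → ℤ) × Fin k → ℝ}

theorem recolored_subset_cell (hδ : 0 < δ) (hx : ∀ i, x i < δ / k) (Q : Fin d → ℤ) (j : Fin k) :
    recolored δ x Q j ⊆ cell δ Q := by
  have hδ' : (0 : ℝ) < δ := by exact_mod_cast hδ
  have hk : (0 : ℝ) < k := by exact_mod_cast j.pos
  intro p hp
  rw [recolored, mem_box] at hp
  refine mem_box.2 fun i => ⟨le_trans ?_ (hp i).1, (hp i).2.trans ?_⟩
  · have : (0 : ℝ) ≤ (j : ℕ) / k := by positivity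
    nlinarith
  · have h1 : ((j : ℕ) : ℝ) + 1 ≤ k := by exact_mod_cast j.2
    have h2 : (δ : ℝ) * (((j : ℕ) : ℝ) / k) + δ / k ≤ δ := by
      rw [mul_div_assoc', ← add_div, div_le_iff₀ hk]
      nlinarith
    have := hx (Q, j)
    linarith

theorem eq_of_mem_recolored (hδ : 0 < δ) (hx : ∀ i, x i < δ / k) {d0 : Fin d} {Q : Fin d → ℤ}
    {j j' : Fin k} {p : Fin d → ℝ} (hp : p ∈ recolored δ x Q j) (hp' : p ∈ recolored δ x Q j') :
    j = j' := by
  have hδ' : (0 : ℝ) < δ := by exact_mod_cast hδ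
  have hk : (0 : ℝ) < k := by exact_mod_cast j.pos
  have key : ∀ {j j' : Fin k}, p ∈ recolored δ x Q j → p ∈ recolored δ x Q j' → ¬ j < j' := by
    intro j j' hp hp' hlt
    have h1 := (mem_box.1 hp d0).2
    have h2 := (mem_box.1 hp' d0).1
    have h3 : ((j : ℕ) : ℝ) + 1 ≤ (j' : ℕ) := by exact_mod_cast hlt
    have h4 : (δ : ℝ) * (((j : ℕ) : ℝ) / k) + δ / k ≤ δ * (((j' : ℕ) : ℝ) / k) := by
      rw [mul_div_assoc', mul_div_assoc', ← add_div, div_le_div_iff_of_pos_right hk]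
      nlinarith
    have := hx (Q, j)
    linarith
  exact le_antisymm (not_lt.1 (key hp' hp)) (not_lt.1 (key hp hp'))

open Classical in
/-- The coloring that is constant on each cell of a grid, apart from the recolored cubes. -/
noncomputable def gridColor (δ : ℚ) (c : (Fin d → ℤ) → Fin k) (x : (Fin d → ℤ) × Fin k → ℝ)
    (p : Fin d → ℝ) : Fin k :=
  if h : ∃ j, p ∈ recolored δ x (cellIndex δ p) j then h.choose else c (cellIndex δ p)

variable {c : (Fin d → ℤ) → Fin k}

theorem gridColor_of_mem (hd : 1 ≤ d) (hδ : 0 < δ) (hx : ∀ i, x i < δ / k) {Q : Fin d → ℤ}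
    {j : Fin k} {p : Fin d → ℝ} (hp : p ∈ recolored δ x Q j) : gridColor δ c x p = j := by
  have hQ : cellIndex δ p = Q := (mem_cell_iff hδ).1 (recolored_subset_cell hδ hx Q j hp)
  have hex : ∃ j, p ∈ recolored δ x (cellIndex δ p) j := ⟨j, hQ ▸ hp⟩
  rw [gridColor, dif_pos hex]
  exact eq_of_mem_recolored hδ hx (d0 := ⟨0, hd⟩) (hQ ▸ hex.choose_spec) hp

theorem gridColor_of_notMem {p : Fin d → ℝ} (hp : ∀ j, p ∉ recolored δ x (cellIndex δ p) j) :
    gridColor δ c x p = c (cellIndex δ p) :=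
  dif_neg (not_exists.2 hp)

theorem cell_inter_gridColor (hd : 1 ≤ d) (hδ : 0 < δ) (hx : ∀ i, x i < δ / k) {Q : Fin d → ℤ}
    {j : Fin k} (hj : j ≠ c Q) : cell δ Q ∩ gridColor δ c x ⁻¹' {j} = recolored δ x Q j := by
  ext p
  constructor
  · rintro ⟨hQ, hp⟩
    rw [mem_cell_iff hδ] at hQ
    by_cases hex : ∃ j, p ∈ recolored δ x (cellIndex δ p) j
    · obtain ⟨j', hj'⟩ := hex
      rw [Set.mem_preimage, gridColor_of_mem hd hδ hx hj', Set.mem_singleton_iff] at hp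
      rw [← hp, ← hQ]
      exact hj'
    · rw [Set.mem_preimage, gridColor_of_notMem (not_exists.1 hex), hQ] at hp
      exact absurd hp.symm hj
  · exact fun hp => ⟨recolored_subset_cell hδ hx Q j hp, gridColor_of_mem hd hδ hx hp⟩

theorem measurable_cellIndex : Measurable (cellIndex δ : (Fin d → ℝ) → (Fin d → ℤ)) :=
  measurable_pi_lambda _ fun i => Int.measurable_floor.comp ((measurable_pi_apply i).div_const _)

theorem measurableSet_gridColor (hd : 1 ≤ d) (hδ : 0 < δ) (hx : ∀ i, x i < δ / k) (j : Fin k) :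
    MeasurableSet (gridColor δ c x ⁻¹' {j}) := by
  have hR : ∀ j, MeasurableSet (⋃ Q, recolored δ x Q j) := fun j =>
    MeasurableSet.iUnion fun Q => measurableSet_box _ _
  have h : gridColor δ c x ⁻¹' {j} = (⋃ Q, recolored δ x Q j) ∪
      (cellIndex δ ⁻¹' {Q | c Q = j} \ ⋃ j', ⋃ Q, recolored δ x Q j') := by
    ext p
    by_cases hex : ∃ j' Q, p ∈ recolored δ x Q j'
    · obtain ⟨j', Q, hp⟩ := hex
      rw [Set.mem_preimage, gridColor_of_mem hd hδ hx hp, Set.mem_singleton_iff]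
      constructor
      · rintro rfl
        exact Or.inl (Set.mem_iUnion.2 ⟨Q, hp⟩)
      · rintro (h | h)
        · obtain ⟨Q', hp'⟩ := Set.mem_iUnion.1 h
          rw [← gridColor_of_mem (c := c) hd hδ hx hp, gridColor_of_mem hd hδ hx hp']
        · exact absurd (Set.mem_iUnion.2 ⟨j', Set.mem_iUnion.2 ⟨Q, hp⟩⟩) h.2
    · have hex' := hex
      push Not at hex'
      rw [Set.mem_preimage, gridColor_of_notMem fun j' => hex' j' _]
      simp [hex']
  rw [h]
  exact (hR j).union ((measurable_cellIndex (MeasurableSet.of_discrete)).diff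
    (MeasurableSet.iUnion hR))

/-- The coloring of a grid, with small recolored cubes. -/
noncomputable def gridColoring (hd : 1 ≤ d) (hδ : 0 < δ) (c : (Fin d → ℤ) → Fin k)
    (hx : ∀ i, x i < δ / k) : Coloring d k where
  color := gridColor δ c x
  measurable_color j := (measurableSet_gridColor hd hδ hx j).nullMeasurableSet

theorem cell_corner_mem (E : Subalgebra ℚ ℝ) (Q : Fin d → ℤ) (r : ℚ) (i : Fin d) :
    (δ : ℝ) * (Q i + r) ∈ E := by
  have := ratCast_mem_subalgebra E (δ * (Q i + r))
  push_cast at this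
  exact this

/-- Inside a cell whose recolored cubes have sides in `E`, boxes with corners in `E` contain an
amount in `E` of every color. -/
theorem measureReal_box_inter_cell_mem (hd : 1 ≤ d) (hδ : 0 < δ) (hx : ∀ i, x i < δ / k)
    (E : Subalgebra ℚ ℝ) {lo hi : Fin d → ℝ} (hlo : ∀ i, lo i ∈ E) (hhi : ∀ i, hi i ∈ E)
    {Q : Fin d → ℤ} (hQ : ∀ j, x (Q, j) ∈ E) (j : Fin k) :
    volume.real (box lo hi ∩ (cell δ Q ∩ gridColor δ c x ⁻¹' {j})) ∈ E := by
  classical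
  have hne : ∀ j, j ≠ c Q →
      volume.real (box lo hi ∩ (cell δ Q ∩ gridColor δ c x ⁻¹' {j})) ∈ E := by
    intro j hj
    rw [cell_inter_gridColor hd hδ hx hj]
    have h1 : ∀ i, (δ : ℝ) * (Q i + (j : ℕ) / k) ∈ E := fun i => by
      simpa using cell_corner_mem (δ := δ) E Q ((j : ℕ) / k : ℚ) i
    exact measureReal_box_inter_box_mem E hlo hhi h1 fun i => add_mem (h1 i) (hQ j)
  by_cases hj : j = c Q
  · have hsum := sum_measureReal_inter_color (gridColoring hd hδ c hx)
      (A := box lo hi ∩ cell δ Q)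
      ((measurableSet_box _ _).inter (measurableSet_box _ _)).nullMeasurableSet
      (ne_top_of_le_ne_top (volume_box_ne_top lo hi) (measure_mono Set.inter_subset_left))
    simp only [Set.inter_assoc] at hsum
    rw [← Finset.add_sum_erase _ _ (Finset.mem_univ j)] at hsum
    have h1 := eq_sub_of_add_eq hsum
    change volume.real (box lo hi ∩ (cell δ Q ∩ gridColor δ c x ⁻¹' {j})) = _ at h1
    rw [h1]
    refine sub_mem (measureReal_box_inter_box_mem E hlo hhi (fun i => ?_) fun i => ?_)
      (sum_mem fun j' hj' => hne j' ?_)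
    · simpa using cell_corner_mem (δ := δ) E Q 0 i
    · simpa using cell_corner_mem (δ := δ) E Q 1 i
    · exact fun h => (Finset.mem_erase.1 hj').1 (h.trans hj.symm)
  · exact hne j hj

theorem measureReal_cell_inter (hd : 1 ≤ d) (hδ : 0 < δ) (hx : ∀ i, x i < δ / k)
    (hx0 : ∀ i, 0 < x i) {Q : Fin d → ℤ} {j : Fin k} (hj : j ≠ c Q) :
    volume.real (cell δ Q ∩ gridColor δ c x ⁻¹' {j}) = x (Q, j) ^ d := by
  rw [cell_inter_gridColor hd hδ hx hj, recolored, measureReal_box]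
  simp [(hx0 (Q, j)).le]

theorem measureReal_eq_sum_cell (hδ : 0 < δ) {A : Set (Fin d → ℝ)}
    (hA : NullMeasurableSet A volume) (hfin : volume A ≠ ∞) (F : Finset (Fin d → ℤ))
    (hF : ∀ p ∈ A, cellIndex δ p ∈ F) :
    volume.real A = ∑ Q ∈ F, volume.real (A ∩ cell δ Q) := by
  rw [← measureReal_biUnion_finset₀]
  · congr 1
    ext p
    simp only [Set.mem_iUnion, Set.mem_inter_iff, exists_prop]
    exact ⟨fun hp => ⟨_, hF p hp, hp, (mem_cell_iff hδ).2 rfl⟩, fun ⟨_, _, hp, _⟩ => hp⟩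
  · intro Q _ Q' _ hQ
    refine Disjoint.aedisjoint (Set.disjoint_left.2 fun p hp hp' => hQ ?_)
    rw [← (mem_cell_iff hδ).1 hp.2, ← (mem_cell_iff hδ).1 hp'.2]
  · exact fun Q _ => hA.inter (measurableSet_box _ _).nullMeasurableSet

end gridColor

/-! ### Cells inside the pieces of a fair splitting -/

namespace Division

variable {d : ℕ} {a : Fin d → ℝ} {s : ℝ}

theorem le_coord (D : Division a s) (i : Fin d) (c : Fin (D.cuts i + 2)) : a i ≤ D.coord i c := by
  rw [← D.coord_zero i]
  exact D.monotone_coord i (Fin.zero_le c)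

theorem coord_le (D : Division a s) (i : Fin d) (c : Fin (D.cuts i + 2)) :
    D.coord i c ≤ a i + s := by
  rw [← D.coord_last i]
  exact D.monotone_coord i (Fin.le_last c)

theorem coord_castSucc_le_succ (D : Division a s) (i : Fin d) (c : Fin (D.cuts i + 1)) :
    D.coord i c.castSucc ≤ D.coord i c.succ :=
  D.monotone_coord i c.castSucc_lt_succ.le

theorem measureReal_piece (D : Division a s) (J : D.Index) :
    volume.real (D.piece J) = ∏ i, (D.coord i (J i).succ - D.coord i (J i).castSucc) := by
  rw [piece, measureReal_Icc_pi]
  exact Finset.prod_congr rfl fun i _ => max_eq_left (sub_nonneg.2 (D.coord_castSucc_le_succ i _))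

theorem equalVolumes_of_fair {k q : ℕ} (D : Division a s) (hs : 0 < s) (f : Coloring d k)
    (label : D.Index → Fin q)
    (hfair : ∀ (j : Fin k) (l : Fin q), ∑ J with label J = l,
      volume.real (D.piece J ∩ f.color ⁻¹' {j}) =
        volume.real (cube a s ∩ f.color ⁻¹' {j}) / q) : D.EqualVolumes label := by
  intro l
  have h1 := Finset.sum_congr rfl fun (j : Fin k) (_ : j ∈ Finset.univ) => hfair j l
  rw [Finset.sum_comm, ← Finset.sum_div, sum_measureReal_inter_color f (A := cube a s)
    measurableSet_Icc.nullMeasurableSet isCompact_Icc.measure_lt_top.ne] at h1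
  have h2 : volume.real (cube a s) = s ^ d := by
    rw [cube, measureReal_Icc_pi]
    simp [hs.le]
  rw [← h2, ← h1]
  refine Finset.sum_congr rfl fun J _ => ?_
  rw [sum_measureReal_inter_color f (A := D.piece J) measurableSet_Icc.nullMeasurableSet
    isCompact_Icc.measure_lt_top.ne, measureReal_piece]

/-- If the grid is fine enough, then every part contains a piece all of whose sides have length at
least `2 * δ`, since the thinner pieces are too small to make up the part. Such a piece contains a
cell. -/
theorem exists_cell_subset {t q : ℕ} (D : Division a s) (hs : 0 < s) (hD : D.size ≤ t)
    (label : D.Index → Fin q) (hvol : D.EqualVolumes label) {δ : ℚ} (hδ : 0 < δ)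
    (hδs : 2 * (δ : ℝ) * ((t : ℝ) + 1) ^ d * q < s) (hd : 1 ≤ d) (l : Fin q) :
    ∃ J Q, label J = l ∧ cell δ Q ⊆ D.openPiece J := by
  classical
  have hδ' : (0 : ℝ) < δ := by exact_mod_cast hδ
  have hq : (0 : ℝ) < q := by exact_mod_cast l.pos
  have hJ : ∃ J, label J = l ∧ ∀ i,
      2 * (δ : ℝ) ≤ D.coord i (J i).succ - D.coord i (J i).castSucc := by
    by_contra! hno
    have hle : ∀ J ∈ Finset.univ.filter (fun J => label J = l),
        ∏ i, (D.coord i (J i).succ - D.coord i (J i).castSucc) ≤ 2 * (δ : ℝ) * s ^ (d - 1) := by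
      intro J hJ
      obtain ⟨i, hi⟩ := hno J (Finset.mem_filter.1 hJ).2
      rw [← Finset.mul_prod_erase _ _ (Finset.mem_univ i)]
      have h1 : ∏ i ∈ Finset.univ.erase i,
          (D.coord i (J i).succ - D.coord i (J i).castSucc) ≤ s ^ (d - 1) := by
        have hcard : (Finset.univ.erase i).card = d - 1 := by
          rw [Finset.card_erase_of_mem (Finset.mem_univ i), Finset.card_univ, Fintype.card_fin]
        rw [← hcard, ← Finset.prod_const]
        refine Finset.prod_le_prod (fun i _ => sub_nonneg.2 (D.coord_castSucc_le_succ i _))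
          fun i _ => ?_
        linarith [D.le_coord i (J i).castSucc, D.coord_le i (J i).succ]
      refine mul_le_mul hi.le h1 (Finset.prod_nonneg fun i _ =>
        sub_nonneg.2 (D.coord_castSucc_le_succ i _)) (by positivity)
    have hsum := Finset.sum_le_sum hle
    rw [hvol l, Finset.sum_const, nsmul_eq_mul] at hsum
    have hcard : ((Finset.univ.filter fun J => label J = l).card : ℝ) ≤ ((t : ℝ) + 1) ^ d := by
      have h1 : (Finset.univ.filter fun J => label J = l).card ≤ (t + 1) ^ d := by
        refine (Finset.card_le_univ _).trans ?_
        rw [Fintype.card_pi]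
        refine (Finset.prod_le_pow_card _ _ (t + 1) fun i _ => ?_).trans (by simp)
        rw [Fintype.card_fin]
        have := Finset.single_le_sum (f := D.cuts) (fun _ _ => Nat.zero_le _) (Finset.mem_univ i)
        exact Nat.succ_le_succ (this.trans hD)
      exact_mod_cast h1
    have h2 : s ^ d / q ≤ ((t : ℝ) + 1) ^ d * (2 * (δ : ℝ) * s ^ (d - 1)) :=
      hsum.trans (mul_le_mul_of_nonneg_right hcard (by positivity))
    have h3 : s ^ d = s * s ^ (d - 1) := by
      rw [← pow_succ', Nat.sub_add_cancel hd]
    rw [div_le_iff₀ hq, h3] at h2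
    have h4 : 0 < s ^ (d - 1) := by positivity
    have h5 := mul_lt_mul_of_pos_right hδs h4
    linarith
  obtain ⟨J, hJl, hJ⟩ := hJ
  refine ⟨J, fun i => ⌈D.coord i (J i).castSucc / δ⌉, hJl, fun p hp => ?_⟩
  rw [cell, mem_box] at hp
  refine mem_box.2 fun i => ?_
  obtain ⟨h1, h2⟩ := hp i
  have h3 := Int.le_ceil (D.coord i (J i).castSucc / δ)
  have h4 := Int.ceil_lt_add_one (D.coord i (J i).castSucc / δ)
  rw [div_le_iff₀ hδ'] at h3
  rw [← sub_lt_iff_lt_add, lt_div_iff₀ hδ'] at h4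
  have h5 := hJ i
  constructor <;> linarith

end Division

/-! ### Generic grid colorings have no fair splittings -/

section generic

variable {d k : ℕ} {δ : ℚ} {x : (Fin d → ℤ) × Fin k → ℝ} {c : (Fin d → ℤ) → Fin k}

/-- In a fair splitting, pick for every part `l` a cell `Q₀ l` inside a piece `J₀ l` of that part.
Let `E` be the set of numbers algebraic over the field generated by `S`, and suppose that it
contains the coordinates of the cuts and the sides of the recolored cubes in all the cells other
than the `Q₀ l` with `l ≠ l₀`. Then the amount of a color in part `l` differs from the amount in
the cell `Q₀ l` by an element of `E`. As all the parts contain the same amount, the sides of the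
recolored cubes in the cells `Q₀ l` are in `E`, too. -/
theorem mem_of_fair (hd : 1 ≤ d) (hδ : 0 < δ) (hx : ∀ i, x i < δ / k) (hx0 : ∀ i, 0 < x i)
    {a : Fin d → ℝ} {s : ℝ} (D : Division a s) {q : ℕ} (label : D.Index → Fin q)
    (hfair : ∀ (j : Fin k) (l : Fin q), ∑ J with label J = l,
      volume.real (D.piece J ∩ gridColor δ c x ⁻¹' {j}) =
        volume.real (cube a s ∩ gridColor δ c x ⁻¹' {j}) / q)
    {J₀ : Fin q → D.Index} {Q₀ : Fin q → Fin d → ℤ} (hJ₀ : ∀ l, label (J₀ l) = l)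
    (hQ₀ : ∀ l, cell δ (Q₀ l) ⊆ D.openPiece (J₀ l)) (l₀ : Fin q)
    (S : Set ℝ) (hcoord : D.coords ⊆ algSpan S)
    (hxE : ∀ Q j, (∀ l, l ≠ l₀ → Q ≠ Q₀ l) → x (Q, j) ∈ algSpan S)
    {l : Fin q} {j : Fin k} (hj : j ≠ c (Q₀ l)) : x (Q₀ l, j) ∈ algSpan S := by
  classical
  set E := algSpan S
  have hcoord' : ∀ i n, D.coord i n ∈ E := fun i n => hcoord (D.coord_mem_coords i n)
  let f : Coloring d k := gridColoring hd hδ c hx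
  have hinjQ : ∀ {l l' J}, cell δ (Q₀ l) ⊆ D.openPiece J → label J = l' → l = l' := by
    intro l l' J hsub hJ
    by_contra hne
    have hJJ : J₀ l ≠ J := fun h => hne (by rw [← hJ, ← h, hJ₀])
    have hp := corner_mem_cell hδ (Q₀ l)
    exact Set.disjoint_left.1 (D.disjoint_openPiece hJJ) (hQ₀ l hp) (hsub hp)
  have hQinj : Function.Injective Q₀ := fun l l' h => hinjQ (J := J₀ l') (h ▸ hQ₀ l') (hJ₀ l')
  let m : (Fin d → ℤ) → ℝ := fun Q => volume.real (cell δ Q ∩ gridColor δ c x ⁻¹' {j})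
  let v : D.Index → (Fin d → ℤ) → ℝ := fun J Q =>
    volume.real (D.openPiece J ∩ (cell δ Q ∩ gridColor δ c x ⁻¹' {j}))
  -- finitely many cells cover the cube; the chosen cells are added for convenience
  let F : Finset (Fin d → ℤ) :=
    Finset.Icc (fun i => ⌊a i / (δ : ℝ)⌋) (fun i => ⌊(a i + s) / (δ : ℝ)⌋) ∪ Finset.univ.image Q₀
  have hδ' : (0 : ℝ) < δ := by exact_mod_cast hδ
  have hpiece : ∀ J, volume.real (D.piece J ∩ gridColor δ c x ⁻¹' {j}) = ∑ Q ∈ F, v J Q := by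
    intro J
    have h1 : volume.real (D.piece J ∩ gridColor δ c x ⁻¹' {j}) =
        volume.real (D.openPiece J ∩ gridColor δ c x ⁻¹' {j}) :=
      measureReal_congr ((D.openPiece_ae_eq_piece J).symm.inter (ae_eq_refl _))
    rw [h1, measureReal_eq_sum_cell hδ (A := D.openPiece J ∩ gridColor δ c x ⁻¹' {j})
      ((measurableSet_box _ _).nullMeasurableSet.inter (f.measurable_color j))
      (ne_top_of_le_ne_top (volume_box_ne_top _ _) (measure_mono Set.inter_subset_left)) F]
    · refine Finset.sum_congr rfl fun Q _ => ?_
      rw [Set.inter_assoc, Set.inter_comm (_ ⁻¹' _)]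
    · intro p hp
      have hp1 := mem_box.1 hp.1
      refine Finset.mem_union_left _ (Finset.mem_Icc.2 ⟨fun i => ?_, fun i => ?_⟩)
      · refine Int.floor_le_floor (div_le_div_of_nonneg_right ?_ hδ'.le)
        exact (D.le_coord i _).trans (hp1 i).1
      · refine Int.floor_le_floor (div_le_div_of_nonneg_right ?_ hδ'.le)
        exact (hp1 i).2.le.trans (D.coord_le i _)
  have hxQ : ∀ Q, (∀ l, l ≠ l₀ → Q ≠ Q₀ l) → ∀ j, x (Q, j) ∈ E := fun Q hQ j => hxE Q j hQ
  have hpart : ∀ l, volume.real (cube a s ∩ gridColor δ c x ⁻¹' {j}) / q - m (Q₀ l) ∈ E := by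
    intro l
    have hm : m (Q₀ l) = ∑ Q ∈ F, if Q = Q₀ l then m Q else 0 := by
      rw [Finset.sum_ite_eq' F (Q₀ l), if_pos]
      exact Finset.mem_union_right _ (Finset.mem_image_of_mem _ (Finset.mem_univ l))
    rw [← hfair j l, Finset.sum_congr rfl fun J _ => hpiece J, Finset.sum_comm, hm,
      ← Finset.sum_sub_distrib]
    refine sum_mem fun Q _ => ?_
    by_cases hQ : ∃ l', Q = Q₀ l'
    · -- a chosen cell lies inside a single piece
      obtain ⟨l', rfl⟩ := hQ
      have hv : ∀ J, v J (Q₀ l') = if J = J₀ l' then m (Q₀ l') else 0 := by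
        intro J
        split_ifs with h
        · subst h
          simp only [v, m]
          rw [← Set.inter_assoc, Set.inter_eq_self_of_subset_right (hQ₀ l')]
        · simp only [v]
          have : D.openPiece J ∩ (cell δ (Q₀ l') ∩ gridColor δ c x ⁻¹' {j}) = ∅ := by
            rw [← Set.disjoint_iff_inter_eq_empty]
            exact (D.disjoint_openPiece h).mono_right (Set.inter_subset_left.trans (hQ₀ l'))
          rw [this, measureReal_empty]
      have hzero : ∑ J with label J = l, v J (Q₀ l') =
          if Q₀ l' = Q₀ l then m (Q₀ l') else 0 := by
        rw [Finset.sum_congr rfl fun J _ => hv J, Finset.sum_ite_eq']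
        simp [hJ₀, hQinj.eq_iff]
      rw [hzero, sub_self]
      exact zero_mem E
    · rw [not_exists] at hQ
      rw [if_neg (hQ l), sub_zero]
      exact sum_mem fun J _ => measureReal_box_inter_cell_mem hd hδ hx E
        (fun i => hcoord' _ _) (fun i => hcoord' _ _) (hxQ Q fun l _ => hQ l) j
  have hm₀ : m (Q₀ l₀) ∈ E := by
    have h1 := measureReal_box_inter_cell_mem (c := c) hd hδ hx E
      (lo := fun i => (δ : ℝ) * Q₀ l₀ i) (hi := fun i => (δ : ℝ) * (Q₀ l₀ i + 1))
      (fun i => by simpa using cell_corner_mem (δ := δ) E (Q₀ l₀) 0 i)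
      (fun i => by simpa using cell_corner_mem (δ := δ) E (Q₀ l₀) 1 i)
      (hxQ (Q₀ l₀) fun l hl h => hl (hQinj h).symm) j
    rw [← Set.inter_assoc] at h1
    change volume.real (cell δ (Q₀ l₀) ∩ cell δ (Q₀ l₀) ∩ _) ∈ E at h1
    rwa [Set.inter_self] at h1
  have hml : m (Q₀ l) ∈ E := by
    have := sub_mem (add_mem (hpart l₀) hm₀) (hpart l)
    simpa using this
  have hpow : x (Q₀ l, j) ^ d ∈ E := by
    rw [← measureReal_cell_inter hd hδ hx hx0 hj]
    exact hml
  exact mem_algSpan_of_pow hd hpow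

/-- If the sides of the recolored cubes are algebraically independent, then the
`(q - 1) * (k - 1)` of them that `mem_of_fair` provides are independent over the others. So they cannot be
algebraic over the coordinates of the cuts, which have smaller rank. -/
theorem not_hasFairSplitting_gridColoring {t q : ℕ} (hd : 1 ≤ d) (hk : 1 ≤ k) (hq : 2 ≤ q)
    (h : t + d + (q - 1) < k * (q - 1) ∨ (d = 1 ∧ t + 2 < k * (q - 1)))
    (hδ : 0 < δ) (hx : ∀ i, x i < δ / k) (hx0 : ∀ i, 0 < x i) (hind : AlgebraicIndependent ℚ x)
    {a : Fin d → ℝ} {s : ℝ} (hδs : 2 * (δ : ℝ) * ((t : ℝ) + 1) ^ d * q < s) :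
    ¬ HasFairSplitting (gridColoring hd hδ c hx) q t a s := by
  classical
  rintro ⟨D, hD, label, hfair⟩
  have hδ' : (0 : ℝ) < δ := by exact_mod_cast hδ
  have hs : 0 < s := lt_of_le_of_lt (by positivity) hδs
  have hfair' : ∀ (j : Fin k) (l : Fin q), ∑ J with label J = l,
      volume.real (D.piece J ∩ (gridColoring hd hδ c hx).color ⁻¹' {j}) =
        volume.real (cube a s ∩ (gridColoring hd hδ c hx).color ⁻¹' {j}) / q := fun j l =>
    (D.fair_iff_sum (by omega) label l ((gridColoring hd hδ c hx).measurable_color j)).1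
      (hfair j l)
  have hvol := D.equalVolumes_of_fair hs _ label hfair'
  choose J₀ Q₀ hJ₀ hQ₀ using D.exists_cell_subset hs hD label hvol hδ hδs hd
  have hQinj : Function.Injective Q₀ := by
    intro l l' hll
    by_contra hne
    have hp := corner_mem_cell hδ (Q₀ l)
    have hJJ : J₀ l ≠ J₀ l' := fun h => hne (by rw [← hJ₀ l, h, hJ₀])
    exact Set.disjoint_left.1 (D.disjoint_openPiece hJJ) (hQ₀ l hp) (hQ₀ l' (hll ▸ hp))
  let l₀ : Fin q := ⟨0, by omega⟩
  let τ : ((l : {l : Fin q // l ≠ l₀}) × {j : Fin k // j ≠ c (Q₀ l)}) → ℝ :=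
    fun o => x (Q₀ o.1, o.2)
  have hτ : Function.Injective τ := by
    rintro ⟨⟨l, hl⟩, ⟨j, hj⟩⟩ ⟨⟨l', hl'⟩, ⟨j', hj'⟩⟩ heq
    have h1 := Prod.ext_iff.1 (hind.injective heq)
    obtain rfl : l = l' := hQinj h1.1
    obtain rfl : j = j' := h1.2
    rfl
  -- all the sides except the ones in question, and the cuts
  set S : Set ℝ := (Set.range x \ Set.range τ) ∪ D.coords
  have hsub : Set.range τ ⊆ algSpan S := by
    rintro _ ⟨⟨⟨l, hl⟩, ⟨j, hj⟩⟩, rfl⟩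
    refine mem_of_fair hd hδ hx hx0 D label hfair' hJ₀ hQ₀ l₀ S
      (Set.subset_union_right.trans (subset_algSpan S)) (fun Q j hQ => ?_) hj
    refine subset_algSpan S (Or.inl ⟨⟨_, rfl⟩, ?_⟩)
    rintro ⟨⟨⟨l', hl'⟩, j'⟩, heq⟩
    exact hQ l' hl' (Prod.ext_iff.1 (hind.injective heq)).1.symm
  rw [coe_algSpan] at hsub
  have hle := encard_le_eRk_of_subset_closure algMatroid (I := Set.range x)
    (AlgebraicIndependent.matroid_indep_iff.2
      ((algebraicIndependent_subtype_range hind.injective).2 hind))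
    (by rintro _ ⟨o, rfl⟩; exact ⟨_, rfl⟩) (Set.subset_univ _) hsub
  have hcard : (Set.range τ).encard = (q - 1) * (k - 1) := by
    rw [← Set.image_univ, hτ.encard_image, Set.encard_univ, ENat.card_eq_coe_fintype_card,
      Fintype.card_sigma]
    simp [Fintype.card_subtype_compl]
  rw [hcard] at hle
  exact absurd (D.eRk_coords_lt hk hq h hs hD label hvol) (not_lt.2 hle)

end generic

/-! ### Density -/

variable {d k : ℕ}

theorem dist_le_of_cellIndex_eq {δ : ℚ} (hδ : 0 < δ) {p p' : Fin d → ℝ}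
    (h : cellIndex δ p = cellIndex δ p') : dist p p' ≤ δ := by
  have hδ' : (0 : ℝ) < δ := by exact_mod_cast hδ
  refine (dist_pi_le_iff hδ'.le).2 fun i => ?_
  have h1 := Int.abs_sub_lt_one_of_floor_eq_floor (congrFun h i)
  rw [← sub_div, abs_div, abs_of_pos hδ', div_lt_one hδ'] at h1
  exact h1.le

/-- Colorings constant on the cells of a fine grid are dense: the color classes contain disjoint
compact sets that almost exhaust a given cube, and each cell of a fine grid meets at most one of
these. -/
theorem exists_grid_approximation (hk : 1 ≤ k) (f : Coloring d k) (n : ℕ) {ε δ₀ : ℝ} (hε : 0 < ε)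
    (hδ₀ : 0 < δ₀) : ∃ δ : ℚ, 0 < δ ∧ (δ : ℝ) < δ₀ ∧ ∃ c : (Fin d → ℤ) → Fin k,
      volume.real {p | p ∈ centeredCube d n ∧ f.color p ≠ c (cellIndex δ p)} ≤ ε := by
  classical
  have hk' : (0 : ℝ) < k := by exact_mod_cast hk
  have hK : ∀ j, ∃ K, K ⊆ centeredCube d n ∩ f.color ⁻¹' {j} ∧ IsCompact K ∧
      volume ((centeredCube d n ∩ f.color ⁻¹' {j}) \ K) < ENNReal.ofReal (ε / k) := by
    intro j
    have hA : NullMeasurableSet (centeredCube d n ∩ f.color ⁻¹' {j}) volume :=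
      measurableSet_Icc.nullMeasurableSet.inter (f.measurable_color j)
    obtain ⟨B, hBA, hB, hBe⟩ := hA.exists_measurable_subset_ae_eq
    have hBfin : volume B ≠ ∞ := ne_top_of_le_ne_top (isCompact_Icc.measure_lt_top (μ := volume)).ne
      (measure_mono (hBA.trans Set.inter_subset_left))
    obtain ⟨K, hKB, hKc, hK⟩ := hB.exists_isCompact_sdiff_lt hBfin
      (ENNReal.ofReal_pos.2 (div_pos hε hk')).ne'
    refine ⟨K, hKB.trans hBA, hKc, ?_⟩
    exact (measure_congr (ae_eq_set_sdiff hBe (ae_eq_refl K))).symm.trans_lt hK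
  choose K hKA hKc hK using hK
  have hsep : ∀ j j', ∃ r : ℝ, 0 < r ∧ (j ≠ j' → ∀ p ∈ K j, ∀ p' ∈ K j', r < dist p p') := by
    intro j j'
    by_cases hj : j = j'
    · exact ⟨1, one_pos, fun h => absurd hj h⟩
    · have hdis : Disjoint (K j) (K j') := Set.disjoint_left.2 fun p hp hp' =>
        hj ((hKA j hp).2.symm.trans (hKA j' hp').2)
      obtain ⟨r, hr, hr'⟩ := Metric.exists_pos_forall_lt_edist (hKc j) (hKc j').isClosed hdis
      refine ⟨r, hr, fun _ p hp p' hp' => ?_⟩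
      have := hr' p hp p' hp'
      rw [edist_nndist] at this
      exact_mod_cast this
  choose r hr hsep using hsep
  -- a mesh smaller than the distance of any two of the compact sets
  have hsmall : ∀ᶠ y : ℝ in 𝓝[>] 0, y < δ₀ ∧ ∀ j j', y < r j j' := by
    refine Eventually.and ?_ (eventually_all.2 fun j => eventually_all.2 fun j' => ?_)
    · exact nhdsWithin_le_nhds (gt_mem_nhds hδ₀)
    · exact nhdsWithin_le_nhds (gt_mem_nhds (hr j j'))
  obtain ⟨y, ⟨hy₀, hyr⟩, hy⟩ := (hsmall.and self_mem_nhdsWithin).exists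
  obtain ⟨δ, hδ, hδy⟩ := exists_rat_btwn (show (0 : ℝ) < y from hy)
  have hδ' : 0 < δ := by exact_mod_cast hδ
  refine ⟨δ, hδ', hδy.trans hy₀, fun Q => if h : ∃ j, ∃ p ∈ K j, cellIndex δ p = Q then h.choose
    else ⟨0, hk⟩, ?_⟩
  have hsub : {p | p ∈ centeredCube d n ∧ f.color p ≠ if h : ∃ j, ∃ p' ∈ K j,
      cellIndex δ p' = cellIndex δ p then h.choose else ⟨0, hk⟩} ⊆
        ⋃ j, (centeredCube d n ∩ f.color ⁻¹' {j}) \ K j := by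
    rintro p ⟨hp, hne⟩
    refine Set.mem_iUnion.2 ⟨f.color p, ⟨hp, rfl⟩, fun hpK => hne ?_⟩
    have hex : ∃ j, ∃ p' ∈ K j, cellIndex δ p' = cellIndex δ p := ⟨_, p, hpK, rfl⟩
    rw [dif_pos hex]
    obtain ⟨p', hp', hpp⟩ := hex.choose_spec
    by_contra hj
    have h1 := hsep _ _ hj p hpK p' hp'
    have h2 := dist_le_of_cellIndex_eq hδ' hpp.symm
    have h3 := hyr (f.color p) hex.choose
    linarith
  refine ENNReal.toReal_le_of_le_ofReal hε.le ((measure_mono hsub).trans ?_)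
  refine (measure_iUnion_le _).trans ?_
  rw [tsum_fintype]
  refine (Finset.sum_le_sum fun j _ => (hK j).le).trans ?_
  rw [Finset.sum_const, Finset.card_univ, Fintype.card_fin, nsmul_eq_mul,
    ← ENNReal.ofReal_natCast, ← ENNReal.ofReal_mul hk'.le]
  exact ENNReal.ofReal_le_ofReal (by rw [mul_div_cancel₀ _ hk'.ne'])

/-- Inside `[-n, n]^d`, recoloring the small cubes costs at most the number of cells times the
number of colors times a bound `η` for the volumes of these cubes. -/
theorem measureReal_diffSet_gridColoring_le (hd : 1 ≤ d) {δ : ℚ} (hδ : 0 < δ)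
    {x : (Fin d → ℤ) × Fin k → ℝ} {c : (Fin d → ℤ) → Fin k} (hx : ∀ i, x i < δ / k)
    (hx0 : ∀ i, 0 < x i) {η : ℝ} (hη : ∀ i, x i ≤ η) (hη1 : η ≤ 1) (f : Coloring d k) (n : ℕ) :
    volume.real (diffSet n f (gridColoring hd hδ c hx)) ≤
      volume.real {p | p ∈ centeredCube d n ∧ f.color p ≠ c (cellIndex δ p)} +
        ((Finset.Icc (fun _ : Fin d => ⌊-(n : ℝ) / δ⌋) (fun _ => ⌊(n : ℝ) / δ⌋)).card * k : ℕ) *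
          η := by
  classical
  have hδ' : (0 : ℝ) < δ := by exact_mod_cast hδ
  set F := Finset.Icc (fun _ : Fin d => ⌊-(n : ℝ) / δ⌋) (fun _ => ⌊(n : ℝ) / δ⌋)
  have hsub : diffSet n f (gridColoring hd hδ c hx) ⊆
      {p | p ∈ centeredCube d n ∧ f.color p ≠ c (cellIndex δ p)} ∪
        ⋃ o ∈ F ×ˢ (Finset.univ : Finset (Fin k)), recolored δ x o.1 o.2 := by
    rintro p ⟨hp, hne⟩
    by_cases hex : ∃ j, p ∈ recolored δ x (cellIndex δ p) j
    · obtain ⟨j, hj⟩ := hex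
      refine Or.inr (Set.mem_iUnion₂.2 ⟨(cellIndex δ p, j), ?_, hj⟩)
      refine Finset.mem_product.2 ⟨Finset.mem_Icc.2 ⟨fun i => ?_, fun i => ?_⟩, Finset.mem_univ _⟩
      · exact Int.floor_le_floor (div_le_div_of_nonneg_right (hp.1 i) hδ'.le)
      · exact Int.floor_le_floor (div_le_div_of_nonneg_right (hp.2 i) hδ'.le)
    · refine Or.inl ⟨hp, fun h => hne (h.trans ?_)⟩
      exact (gridColor_of_notMem (not_exists.1 hex)).symm
  have hfin : volume {p | p ∈ centeredCube d n ∧ f.color p ≠ c (cellIndex δ p)} ≠ ∞ :=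
    ne_top_of_le_ne_top (isCompact_Icc.measure_lt_top (μ := volume)).ne
      (measure_mono (fun p hp => hp.1 : _ ⊆ centeredCube d n))
  have hfin' : volume (⋃ o ∈ F ×ˢ (Finset.univ : Finset (Fin k)), recolored δ x o.1 o.2) ≠ ∞ :=
    (measure_biUnion_lt_top (Finset.finite_toSet _)
      fun o _ => (volume_box_ne_top _ _).lt_top).ne
  refine (measureReal_mono hsub (measure_union_ne_top hfin hfin')).trans
    ((measureReal_union_le _ _).trans ?_)
  gcongr
  refine (measureReal_biUnion_finset_le _ _).trans ?_
  have hle : ∀ o ∈ F ×ˢ (Finset.univ : Finset (Fin k)),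
      volume.real (recolored δ x o.1 o.2) ≤ η := by
    intro o _
    have h0 := (hx0 o).le
    have h1 : x o ≤ 1 := (hη o).trans hη1
    rw [recolored, measureReal_box]
    have : ∏ _i : Fin d, max (x o) 0 ≤ η := by
      rw [max_eq_left h0, Finset.prod_const, Finset.card_univ, Fintype.card_fin]
      exact (pow_le_of_le_one h0 h1 (by omega)).trans (hη o)
    simpa using this
  refine (Finset.sum_le_sum hle).trans ?_
  rw [Finset.sum_const, nsmul_eq_mul, Finset.card_product, Finset.card_univ, Fintype.card_fin]

theorem dense_compl_splittable {t q : ℕ} (hd : 1 ≤ d) (hk : 1 ≤ k) (hq : 2 ≤ q)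
    (h : t + d + (q - 1) < k * (q - 1) ∨ (d = 1 ∧ t + 2 < k * (q - 1))) (N : ℕ) :
    Dense (splittable d k q t N)ᶜ := by
  rw [Metric.dense_iff]
  intro f r hr
  have hk' : (0 : ℝ) < k := by exact_mod_cast hk
  have hq' : (0 : ℝ) < q := by positivity
  -- only the cube `[-n, n]^d` matters for approximation within `r`
  obtain ⟨n, hn⟩ := exists_pow_lt_of_lt_one (half_pos hr) (show (1 / 2 : ℝ) < 1 by norm_num)
  set A : ℝ := 2 * ((t : ℝ) + 1) ^ d * q with hA
  have hApos : 0 < A := by positivity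
  obtain ⟨δ, hδ, hδA, c, hc⟩ := exists_grid_approximation hk f n (ε := r / 4) (by positivity)
    (δ₀ := 1 / ((N : ℝ) + 1) / A) (by positivity)
  have hδ' : (0 : ℝ) < δ := by exact_mod_cast hδ
  set M : ℕ := (Finset.Icc (fun _ : Fin d => ⌊-(n : ℝ) / δ⌋) (fun _ => ⌊(n : ℝ) / δ⌋)).card * k
  -- the three bounds make the recolored cubes fit into their cells, make their volumes less than
  -- their sides, and make their total volume inside `[-n, n]^d` at most `r / 4`
  set η : ℝ := min (min ((δ : ℝ) / k) 1) (r / (4 * ((M : ℝ) + 1))) with hη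
  have hηpos : 0 < η := by positivity
  obtain ⟨x, hind, hx⟩ := exists_algebraicIndependent_small ((Fin d → ℤ) × Fin k) hηpos
  have hx1 : ∀ i, x i < δ / k := fun i =>
    (hx i).2.trans_le ((min_le_left _ _).trans (min_le_left _ _))
  have hMη : (M : ℝ) * η ≤ r / 4 := by
    have h1 : η ≤ r / (4 * ((M : ℝ) + 1)) := min_le_right _ _
    have h2 : (M : ℝ) * (r / (4 * ((M : ℝ) + 1))) ≤ r / 4 := by
      rw [mul_div_assoc', div_le_div_iff₀ (by positivity) (by norm_num)]
      nlinarith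
    exact (mul_le_mul_of_nonneg_left h1 (Nat.cast_nonneg M)).trans h2
  refine ⟨gridColoring hd hδ c hx1, ?_, ?_⟩
  · rw [Metric.mem_ball, dist_comm]
    have h1 := dist_le_measureReal_diffSet_add n f (gridColoring hd hδ c hx1)
    have h2 := measureReal_diffSet_gridColoring_le hd hδ (c := c) hx1 (fun i => (hx i).1)
      (fun i => (hx i).2.le) ((min_le_left _ _).trans (min_le_right _ _)) f n
    linarith
  · rintro ⟨a, s, -, hs, hfair⟩
    refine not_hasFairSplitting_gridColoring hd hk hq h hδ hx1 (fun i => (hx i).1) hind ?_ hfair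
    rw [lt_div_iff₀ hApos] at hδA
    refine lt_of_eq_of_lt ?_ (hδA.trans_le hs)
    rw [hA]
    ring

theorem avoidsFairSplittings_of_forall_notMem {t q : ℕ} {f : Coloring d k}
    (hf : ∀ n, f ∉ splittable d k q t n) : AvoidsFairSplittings f q t := by
  intro a s hs hfair
  obtain ⟨n₁, hn₁⟩ := exists_mem_centeredCube a
  obtain ⟨n₂, hn₂⟩ := exists_mem_centeredCube fun i => a i + s
  obtain ⟨n₃, hn₃⟩ := exists_nat_ge (1 / s)
  have c1 := (Nat.cast_nonneg n₁ : (0 : ℝ) ≤ n₁)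
  have c2 := (Nat.cast_nonneg n₂ : (0 : ℝ) ≤ n₂)
  have c3 := (Nat.cast_nonneg n₃ : (0 : ℝ) ≤ n₃)
  refine hf (n₁ + n₂ + n₃ + 1) ⟨a, s, Set.Icc_subset_Icc (fun i => ?_) (fun i => ?_), ?_, hfair⟩
  · have := hn₁.1 i
    push_cast at this ⊢
    linarith
  · have := hn₂.2 i
    push_cast at this ⊢
    linarith
  · rw [div_le_iff₀ (by positivity)]
    rw [div_le_iff₀ hs] at hn₃
    push_cast
    nlinarith

end Necklace

theorem mainTheorem5 (d k t q : ℕ) (hd : 1 ≤ d) (hk : 1 ≤ k) (ht : 1 ≤ t) (hq : 2 ≤ q)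
    (h : t + d + (q - 1) < k * (q - 1) ∨ (d = 1 ∧ t + 2 < k * (q - 1))) :
    (∃ f : Necklace.Coloring d k, Necklace.AvoidsFairSplittings f q t) ∧
      Dense {F : Necklace.ColoringSpace d k |
        ∀ f : Necklace.Coloring d k, SeparationQuotient.mk f = F →
          Necklace.AvoidsFairSplittings f q t} := by
  have hclosed : ∀ n, IsClosed (Necklace.splittable d k q t n) := fun n =>
    Necklace.isClosed_splittable n hd (by omega)
  have hdense : Dense (⋂ n, (Necklace.splittable d k q t n)ᶜ) :=
    dense_iInter_of_isOpen_nat (fun n => (hclosed n).isOpen_compl)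
      (Necklace.dense_compl_splittable hd hk hq h)
  constructor
  · let f₀ : Necklace.Coloring d k := ⟨fun _ => ⟨0, hk⟩, fun j =>
      (measurable_const (measurableSet_singleton j)).nullMeasurableSet⟩
    have : Nonempty (Necklace.Coloring d k) := ⟨f₀⟩
    obtain ⟨f, hf⟩ := hdense.nonempty
    exact ⟨f, Necklace.avoidsFairSplittings_of_forall_notMem fun n => Set.mem_iInter.1 hf n⟩
  · refine (SeparationQuotient.surjective_mk.denseRange.dense_image
      SeparationQuotient.continuous_mk hdense).mono ?_
    rintro _ ⟨g, hg, rfl⟩ f hfg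
    refine Necklace.avoidsFairSplittings_of_forall_notMem fun n hf => ?_
    -- a closed set does not separate colorings at distance zero
    exact Set.mem_iInter.1 hg n
      (((SeparationQuotient.mk_eq_mk.1 hfg).mem_closed_iff (hclosed n)).1 hf)
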